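/- Let $N\ge 3$, $k\in\mathbb N$, $h_1,\dots,h_k\in C^1(\mathbb S^{N-1})$, let $a_1,\dots,a_k\in\mathbb R^N$ be pairwise distinct, and put $2^*=\frac{2N}{N-2}$. Let $\mathcal D^{1,2}(\mathbb R^N)$ be the closure of $C_c^\infty(\mathbb R^N)$ with respect to the norm $\|u\|_{\mathcal D^{1,2}}=\big(\int_{\mathbb R^N}|\nabla u|^2\,dx\big)^{1/2}$ (a subspace of $L^{2^*}(\mathbb R^N)$), and for $h\in C^1(\mathbb S^{N-1})$ let $$\mu_1(h)=\inf_{\psi\in H^1(\mathbb S^{N-1})\setminus\{0\}}\frac{\int_{\mathbb S^{N-1}}|\nabla_{\mathbb S^{N-1}}\psi|^2\,dV-\int_{\mathbb S^{N-1}}h\,\psi^2\,dV}{\int_{\mathbb S^{N-1}}\psi^2\,dV}$$ be the first eigenvalue of $-\Delta_{\mathbb S^{N-1}}-h$ on $\mathbb S^{N-1}$. Assume that $$\mu_1(h_i)>-\Big(\frac{N-2}2\Big)^2\ \text{ for all } i=1,\dots,k,\qquad \mu_1\Big(\sum_{i=1}^k h_i\Big)>-\Big(\frac{N-2}2\Big)^2,$$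 and that there is $v\in\mathcal D^{1,2}(\mathbb R^N)$ with $v>0$ a.e. that solves, weakly, $$-\Delta v-\sum_{i=1}^k\frac{h_i\big(\frac{x-a_i}{|x-a_i|}\big)}{|x-a_i|^2}\,v=v^{2^*-1}\quad\text{in }\mathbb R^N\setminus\{a_1,\dots,a_k\},$$ that is, for every $\varphi\in C_c^\infty(\mathbb R^N\setminus\{a_1,\dots,a_k\})$, $$\int_{\mathbb R^N}\nabla v\cdot\nabla\varphi\,dx-\sum_{i=1}^k\int_{\mathbb R^N}\frac{h_i\big(\frac{x-a_i}{|x-a_i|}\big)}{|x-a_i|^2}\,v\,\varphi\,dx=\int_{\mathbb R^N}v^{2^*-1}\varphi\,dx.$$ Then the quadratic form $$\mathcal Q(u)=\int_{\mathbb R^N}|\nabla u|^2\,dx-\sum_{i=1}^k\int_{\mathbb R^N}\frac{h_i\big(\frac{x-a_i}{|x-a_i|}\big)}{|x-a_i|^2}\,u^2\,dx$$ is positive definite on $\mathcal D^{1,2}(\mathbb R^N)$, i.e. $$\mu(h_1,\dots,h_k,a_1,\dots,a_k):=\inf_{u\in\mathcal D^{1,2}(\mathbb R^N)\setminus\{0\}}\frac{\mathcal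 Q(u)}{\|u\|_{\mathcal D^{1,2}}^2}>0.$$ -/

import Mathlib

open MeasureTheory Filter Topology Metric
open scoped ContDiff Manifold RealInnerProductSpace

/-- Euclidean space `ℝ^N`. -/
abbrev RN (N : ℕ) : Type := EuclideanSpace ℝ (Fin N)

/-- The unit sphere `𝕊^{N-1}` of `ℝ^N`. -/
abbrev Sph (N : ℕ) : Type := sphere (0 : RN N) 1

instance factFinrankRN (N : ℕ) [hN : Fact (3 ≤ N)] :
    Fact (Module.finrank ℝ (RN N) = (N - 1) + 1) :=
  ⟨by have := hN.out; simp; omega⟩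

/-- The surface measure on `𝕊^{N-1}`. -/
noncomputable def surfaceMeasure (N : ℕ) : Measure (Sph N) :=
  (volume : Measure (RN N)).toSphere

/-- `f ∈ C^r(𝕊^{N-1})`, for the standard smooth structure of the sphere. -/
def SphereContDiff {N : ℕ} [Fact (3 ≤ N)] (r : ℕ∞) (f : Sph N → ℝ) : Prop :=
  ContMDiff (𝓡 (N - 1)) 𝓘(ℝ, ℝ) r f

open Classical in
/-- The function `x ↦ f (x / |x|)` on `ℝ^N \ {0}` (with the value `0` at the origin). -/
noncomputable def angular {N : ℕ} (f : Sph N → ℝ) (x : RN N) : ℝ :=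
  if hx : x = 0 then 0
  else f ⟨‖x‖⁻¹ • x, by simp [norm_smul, hx]⟩

/-- The gradient on the sphere of a smooth function, as a vector field along the sphere with
values in `ℝ^N`: it is the Euclidean gradient of the `0`-homogeneous extension. -/
noncomputable def sphereGrad {N : ℕ} (f : Sph N → ℝ) (θ : Sph N) : RN N :=
  gradient (angular f) (θ : RN N)

/-- `ψ ∈ H¹(𝕊^{N-1})` with gradient `G`: the pair `(ψ, G)` is in the `L² × L²` closure of the
pairs `(f, ∇f)`, `f ∈ C^∞(𝕊^{N-1})`. -/
def HasH1SphereGrad {N : ℕ} [Fact (3 ≤ N)] (ψ : Sph N → ℝ) (G : Sph N → RN N) : Prop :=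
  MemLp ψ 2 (surfaceMeasure N) ∧ MemLp G 2 (surfaceMeasure N) ∧
  ∃ f : ℕ → Sph N → ℝ, (∀ n, SphereContDiff ⊤ (f n)) ∧
    Tendsto (fun n => eLpNorm (f n - ψ) 2 (surfaceMeasure N)) atTop (𝓝 0) ∧
    Tendsto (fun n => eLpNorm (sphereGrad (f n) - G) 2 (surfaceMeasure N)) atTop (𝓝 0)

/-- `μ₁(h)`, the first eigenvalue of `-Δ - h` on `𝕊^{N-1}`, through its Rayleigh quotient. -/
noncomputable def sphereFirstEigenvalue {N : ℕ} [Fact (3 ≤ N)] (h : Sph N → ℝ) : ℝ :=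
  sInf {t : ℝ | ∃ (ψ : Sph N → ℝ) (G : Sph N → RN N),
    HasH1SphereGrad ψ G ∧ ¬ ψ =ᵐ[surfaceMeasure N] 0 ∧
    t = ((∫ θ, ‖G θ‖ ^ 2 ∂surfaceMeasure N) - ∫ θ, h θ * ψ θ ^ 2 ∂surfaceMeasure N) /
      ∫ θ, ψ θ ^ 2 ∂surfaceMeasure N}

/-- The critical Sobolev exponent `2^* = 2N / (N - 2)`. -/
noncomputable def critExp (N : ℕ) : ℝ := 2 * (N : ℝ) / ((N : ℝ) - 2)

/-- `u ∈ 𝒟^{1,2}(ℝ^N)` with gradient `G`, where `𝒟^{1,2}(ℝ^N)` is the closure of `C_c^∞(ℝ^N)` in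
the norm `‖∇u‖_{L²}`, realized as a space of functions in `L^{2^*}` by Sobolev's inequality. -/
def HasD12Grad {N : ℕ} (u : RN N → ℝ) (G : RN N → RN N) : Prop :=
  MemLp u (ENNReal.ofReal (critExp N)) ∧ MemLp G 2 ∧
  ∃ φ : ℕ → RN N → ℝ, (∀ n, ContDiff ℝ ∞ (φ n) ∧ HasCompactSupport (φ n)) ∧
    Tendsto (fun n => eLpNorm (φ n - u) (ENNReal.ofReal (critExp N))) atTop (𝓝 0) ∧
    Tendsto (fun n => eLpNorm (gradient (φ n) - G) 2) atTop (𝓝 0)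

/-- The potential `h((x - a)/|x - a|) / |x - a|²` with pole `a`. -/
noncomputable def polePotential {N : ℕ} (h : Sph N → ℝ) (a x : RN N) : ℝ :=
  angular h (x - a) / ‖x - a‖ ^ 2

/-- The quadratic form `𝒬(u) = ∫ |∇u|² - ∑ᵢ ∫ hᵢ((x - aᵢ)/|x - aᵢ|) / |x - aᵢ|² u²`, where `G`
is the gradient of `u`. -/
noncomputable def quadForm {N k : ℕ} (h : Fin k → Sph N → ℝ) (a : Fin k → RN N)
    (u : RN N → ℝ) (G : RN N → RN N) : ℝ :=
  (∫ x, ‖G x‖ ^ 2) - ∑ i, ∫ x, polePotential (h i) (a i) x * u x ^ 2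

/-- `μ(h₁,…,h_k,a₁,…,a_k)`, the infimum over `𝒟^{1,2}(ℝ^N) \ {0}` of `𝒬(u) / ‖∇u‖²`. -/
noncomputable def formInf {N k : ℕ} (h : Fin k → Sph N → ℝ) (a : Fin k → RN N) : ℝ :=
  sInf {t : ℝ | ∃ (u : RN N → ℝ) (G : RN N → RN N),
    HasD12Grad u G ∧ ¬ u =ᵐ[volume] 0 ∧ t = quadForm h a u G / ∫ x, ‖G x‖ ^ 2}

/-- `u` is a positive `𝒟^{1,2}(ℝ^N)`-solution of
`-Δu - ∑ᵢ hᵢ((x - aᵢ)/|x - aᵢ|) / |x - aᵢ|² u = u^{2^* - 1}` in `ℝ^N \ {a₁,…,a_k}`, in the weak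
sense. -/
def IsPositiveD12Solution {N k : ℕ} (h : Fin k → Sph N → ℝ) (a : Fin k → RN N)
    (u : RN N → ℝ) : Prop :=
  (∀ᵐ x, 0 < u x) ∧
  ∃ G : RN N → RN N, HasD12Grad u G ∧
    ∀ φ : RN N → ℝ, ContDiff ℝ ∞ φ → HasCompactSupport φ →
      Disjoint (tsupport φ) (Set.range a) →
      (∫ x, ⟪G x, gradient φ x⟫) - ∑ i, ∫ x, polePotential (h i) (a i) x * u x * φ x =
        ∫ x, u x ^ (critExp N - 1) * φ x

/-! Hardy's inequality, sharpened on spheres by the hypotheses on `μ₁(hᵢ)` and `μ₁(∑ hᵢ)`, holds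
near each pole and near infinity. A quadratic partition of unity patches these estimates together:
`𝒬(φ) ≥ δ ‖∇φ‖² - C ∫_B φ²` for some ball `B`. Testing the equation for `v` with `φ² / (v + ε)` and
letting `ε → 0` gives `𝒬(φ) ≥ ∫ v ^ (2^* - 2) φ²`. On the part of `B` where `v` is bounded below
this controls `∫ φ²`; the remaining part of `B` has small measure, so there Sobolev's inequality
absorbs `∫ φ²` into `‖∇φ‖²`. Hence `𝒬(φ) ≥ c ‖∇φ‖²` for smooth `φ` supported away from the poles.
Since `N ≥ 3`, points have zero capacity, and such `φ` are dense in `𝒟^{1,2}`. -/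

section Gradient

variable {E : Type*} [NormedAddCommGroup E] [InnerProductSpace ℝ E] [CompleteSpace E]
  {f g : E → ℝ} {x : E}

lemma norm_gradient_eq (f : E → ℝ) (x : E) : ‖gradient f x‖ = ‖fderiv ℝ f x‖ := by
  simp [gradient]

lemma continuous_gradient (hf : ContDiff ℝ 1 f) : Continuous (gradient f) :=
  (InnerProductSpace.toDual ℝ E).symm.continuous.comp (hf.continuous_fderiv one_ne_zero)

lemma support_gradient_subset (f : E → ℝ) : Function.support (gradient f) ⊆ tsupport f :=
  fun _ hx => support_fderiv_subset ℝ fun h0 => hx (by simp [gradient, h0])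

lemma gradient_mul (hf : DifferentiableAt ℝ f x) (hg : DifferentiableAt ℝ g x) :
    gradient (fun y => f y * g y) x = f x • gradient g x + g x • gradient f x := by
  simp [gradient, fderiv_fun_mul hf hg]

lemma gradient_sub (hf : Differentiable ℝ f) (hg : Differentiable ℝ g) :
    gradient (f - g) = gradient f - gradient g := by
  ext1 x
  simp [gradient, fderiv_sub (hf x) (hg x)]

lemma gradient_scomp {F : ℝ → ℝ} (hF : DifferentiableAt ℝ F (f x)) (hf : DifferentiableAt ℝ f x) :
    gradient (fun y => F (f y)) x = deriv F (f x) • gradient f x := by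
  have hcomp : fderiv ℝ (fun y => F (f y)) x = deriv F (f x) • fderiv ℝ f x :=
    (hF.hasDerivAt.comp_hasFDerivAt x hf.hasFDerivAt).fderiv
  simp [gradient, hcomp]

lemma gradient_comp_add_right (f : E → ℝ) (a x : E) :
    gradient (fun y => f (y + a)) x = gradient f (x + a) := by
  rw [gradient, gradient, fderiv_comp_add_right]

variable [MeasurableSpace E] [BorelSpace E] {μ : Measure E} [IsFiniteMeasureOnCompacts μ]

lemma memLp_gradient (hf : ContDiff ℝ 1 f) (hc : HasCompactSupport f) (p : ENNReal) :
    MemLp (gradient f) p μ :=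
  (continuous_gradient hf).memLp_of_hasCompactSupport (hc.mono' (support_gradient_subset f))

lemma integrable_normSq_gradient (hf : ContDiff ℝ 1 f) (hc : HasCompactSupport f) :
    Integrable (fun x => ‖gradient f x‖ ^ 2) μ :=
  (memLp_gradient hf hc 2).integrable_norm_pow two_ne_zero

end Gradient

section TestFunction

variable {E : Type*} [NormedAddCommGroup E] [NormedSpace ℝ E] {s t : Set E} {φ f g : E → ℝ}

/-- Smooth functions with compact support contained in the complement of `s`, i.e. the elements of
`C_c^∞(E ∖ s)` when `s` is closed. -/
structure IsTestFunction (s : Set E) (φ : E → ℝ) : Prop where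
  contDiff : ContDiff ℝ ∞ φ
  hasCompactSupport : HasCompactSupport φ
  disjoint : Disjoint (tsupport φ) s

namespace IsTestFunction

lemma mono (hφ : IsTestFunction s φ) (hst : t ⊆ s) : IsTestFunction t φ :=
  ⟨hφ.contDiff, hφ.hasCompactSupport, hφ.disjoint.mono_right hst⟩

lemma of_contDiff_of_hasCompactSupport (hφ : ContDiff ℝ ∞ φ) (hc : HasCompactSupport φ) :
    IsTestFunction ∅ φ :=
  ⟨hφ, hc, Set.disjoint_empty _⟩

lemma contDiff_one (hφ : IsTestFunction s φ) : ContDiff ℝ 1 φ :=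
  hφ.contDiff.of_le (by simp)

lemma differentiable (hφ : IsTestFunction s φ) : Differentiable ℝ φ :=
  hφ.contDiff.differentiable (by simp)

lemma continuous (hφ : IsTestFunction s φ) : Continuous φ :=
  hφ.contDiff.continuous

lemma eventuallyEq_zero (hφ : IsTestFunction s φ) {x : E} (hx : x ∈ s) : φ =ᶠ[𝓝 x] 0 :=
  notMem_tsupport_iff_eventuallyEq.1 fun h => Set.disjoint_left.1 hφ.disjoint h hx

lemma mul_left_of_contDiffOn (hφ : IsTestFunction s φ) (hs : IsClosed s)
    (hf : ContDiffOn ℝ ∞ f sᶜ) : IsTestFunction s (fun x => f x * φ x) where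
  contDiff := contDiff_iff_contDiffAt.2 fun x => by
    by_cases hx : x ∈ s
    · refine (contDiffAt_const (c := (0 : ℝ))).congr_of_eventuallyEq ?_
      filter_upwards [hφ.eventuallyEq_zero hx] with y hy
      simp [hy]
    · exact (hf.contDiffAt (hs.isOpen_compl.mem_nhds hx)).mul hφ.contDiff.contDiffAt
  hasCompactSupport := hφ.hasCompactSupport.mul_left
  disjoint := hφ.disjoint.mono_left (tsupport_mul_subset_right (f := f))

lemma mul_left (hφ : IsTestFunction s φ) (hf : ContDiff ℝ ∞ f) :
    IsTestFunction s (fun x => f x * φ x) where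
  contDiff := hf.mul hφ.contDiff
  hasCompactSupport := hφ.hasCompactSupport.mul_left
  disjoint := hφ.disjoint.mono_left (tsupport_mul_subset_right (f := f))

lemma sub (hφ : IsTestFunction s φ) (hf : IsTestFunction s f) : IsTestFunction s (φ - f) where
  contDiff := hφ.contDiff.sub hf.contDiff
  hasCompactSupport := hφ.hasCompactSupport.sub hf.hasCompactSupport
  disjoint := (hφ.disjoint.union_left hf.disjoint).mono_left (tsupport_sub φ f)

lemma sq (hφ : IsTestFunction s φ) : IsTestFunction s (fun x => φ x ^ 2) := by
  simpa only [pow_two] using hφ.mul_left hφ.contDiff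

lemma comp_add_right (hφ : IsTestFunction s φ) (a : E) :
    IsTestFunction ((· + a) ⁻¹' s) (fun x => φ (x + a)) where
  contDiff := hφ.contDiff.comp (contDiff_id.add contDiff_const)
  hasCompactSupport := hφ.hasCompactSupport.comp_homeomorph (Homeomorph.addRight a)
  disjoint := by
    have htsupport : tsupport (fun x => φ (x + a)) = (· + a) ⁻¹' tsupport φ :=
      tsupport_comp_eq_preimage φ (Homeomorph.addRight a)
    rw [htsupport]
    exact hφ.disjoint.preimage _

lemma continuous_mul (hφ : IsTestFunction s φ) (hs : IsClosed s) (hf : ContinuousOn f sᶜ)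
    (hg : Continuous g) (hsupp : Function.support g ⊆ tsupport φ) :
    Continuous (fun x => f x * g x) := by
  refine continuous_iff_continuousAt.2 fun x => ?_
  by_cases hx : x ∈ s
  · have hzero : (fun y => f y * g y) =ᶠ[𝓝 x] fun _ => 0 := by
      have hx' : (tsupport φ)ᶜ ∈ 𝓝 x := (isClosed_tsupport φ).isOpen_compl.mem_nhds
        fun h => Set.disjoint_left.1 hφ.disjoint h hx
      filter_upwards [hx'] with y hy
      rw [Function.notMem_support.1 fun h => hy (hsupp h), mul_zero]
    exact continuousAt_const.congr hzero.symm
  · exact (hf.continuousAt (hs.isOpen_compl.mem_nhds hx)).mul hg.continuousAt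

variable [MeasurableSpace E] [OpensMeasurableSpace E] {μ : Measure E} [IsFiniteMeasureOnCompacts μ]

lemma integrable_mul (hφ : IsTestFunction s φ) (hs : IsClosed s) (hf : ContinuousOn f sᶜ)
    (hg : Continuous g) (hsupp : Function.support g ⊆ tsupport φ) :
    Integrable (fun x => f x * g x) μ :=
  (hφ.continuous_mul hs hf hg hsupp).integrable_of_hasCompactSupport
    (hφ.hasCompactSupport.mono' hsupp).mul_left

lemma memLp_mul (hφ : IsTestFunction s φ) (hs : IsClosed s) (hf : ContinuousOn f sᶜ)
    (p : ENNReal) : MemLp (fun x => f x * φ x) p μ :=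
  (hφ.continuous_mul hs hf hφ.continuous (subset_tsupport φ)).memLp_of_hasCompactSupport
    hφ.hasCompactSupport.mul_left

lemma integrable_mul_sq (hφ : IsTestFunction s φ) (hs : IsClosed s) (hf : ContinuousOn f sᶜ) :
    Integrable (fun x => f x * φ x ^ 2) μ :=
  hφ.integrable_mul hs hf (hφ.continuous.pow 2) fun x hx =>
    subset_tsupport φ fun h0 => hx (by simp [h0])

lemma integrable_sq (hφ : IsTestFunction s φ) : Integrable (fun x => φ x ^ 2) μ :=
  hφ.sq.continuous.integrable_of_hasCompactSupport hφ.sq.hasCompactSupport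

end IsTestFunction

end TestFunction

section Convergence

variable {α F : Type*} [MeasurableSpace α] {μ : Measure α} [NormedAddCommGroup F]

lemma eLpNorm_sub_le_add {f g w : α → F} {p : ENNReal} (hf : AEStronglyMeasurable f μ)
    (hg : AEStronglyMeasurable g μ) (hw : AEStronglyMeasurable w μ) (hp : 1 ≤ p) :
    eLpNorm (f - w) p μ ≤ eLpNorm (f - g) p μ + eLpNorm (g - w) p μ := by
  rw [← sub_add_sub_cancel f g w]
  exact eLpNorm_add_le (hf.sub hg) (hg.sub hw) hp

lemma tendsto_eLpNorm_zero_of_dominated {p : ENNReal} (hp0 : p ≠ 0) (hp : p ≠ ⊤)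
    {f : ℕ → α → F} {b : α → ℝ} (hf : ∀ n, AEStronglyMeasurable (f n) μ) (hb : MemLp b p μ)
    (hfb : ∀ n, ∀ᵐ x ∂μ, ‖f n x‖ ≤ b x) (hlim : ∀ᵐ x ∂μ, Tendsto (fun n => f n x) atTop (𝓝 0)) :
    Tendsto (fun n => eLpNorm (f n) p μ) atTop (𝓝 0) := by
  have hp' : 0 < p.toReal := ENNReal.toReal_pos hp0 hp
  have rpow_tendsto_zero : ∀ {r : ℝ}, 0 < r → Tendsto (fun t : ENNReal => t ^ r) (𝓝 0) (𝓝 0) :=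
    fun {r} hr => by
      simpa only [ENNReal.zero_rpow_of_pos hr] using
        (ENNReal.continuous_rpow_const (y := r)).tendsto 0
  have hlintegral : Tendsto (fun n => ∫⁻ x, ‖f n x‖ₑ ^ p.toReal ∂μ) atTop (𝓝 (∫⁻ _, 0 ∂μ)) := by
    refine tendsto_lintegral_of_dominated_convergence' (fun x => ‖b x‖ₑ ^ p.toReal)
      (fun n => (hf n).enorm.pow_const _) (fun n => ?_)
      (lintegral_rpow_enorm_lt_top_of_eLpNorm_lt_top hp0 hp hb.eLpNorm_lt_top).ne ?_
    · filter_upwards [hfb n] with x hx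
      gcongr
      exact enorm_le_iff_norm_le.2 (hx.trans (le_abs_self _))
    · filter_upwards [hlim] with x hx
      exact (rpow_tendsto_zero hp').comp (by simpa using hx.enorm)
  rw [lintegral_zero] at hlintegral
  simp only [eLpNorm_eq_lintegral_rpow_enorm_toReal hp0 hp]
  exact (rpow_tendsto_zero (one_div_pos.2 hp')).comp hlintegral

lemma tendsto_eLpNorm_smul_sub [NormedSpace ℝ F] {p : ENNReal} (hp0 : p ≠ 0) (hp : p ≠ ⊤)
    {c : ℕ → α → ℝ} {c₀ : α → ℝ} {f : α → F} {C : ℝ}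
    (hc : ∀ n, AEStronglyMeasurable (c n) μ) (hc₀ : AEStronglyMeasurable c₀ μ)
    (hb : ∀ n x, |c n x| ≤ C) (hlim : ∀ᵐ x ∂μ, Tendsto (fun n => c n x) atTop (𝓝 (c₀ x)))
    (hf : MemLp f p μ) :
    Tendsto (fun n => eLpNorm ((fun x => c n x • f x) - fun x => c₀ x • f x) p μ)
      atTop (𝓝 0) := by
  refine tendsto_eLpNorm_zero_of_dominated hp0 hp
    (fun n => ((hc n).smul hf.1).sub (hc₀.smul hf.1)) (hf.norm.const_mul (2 * C)) (fun n => ?_) ?_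
  · filter_upwards [hlim] with x hx
    have hc₀C : |c₀ x| ≤ C := le_of_tendsto hx.abs (Eventually.of_forall fun n => hb n x)
    rw [Pi.sub_apply, ← sub_smul, norm_smul, Real.norm_eq_abs]
    gcongr
    linarith [abs_sub (c n x) (c₀ x), hb n x]
  · filter_upwards [hlim] with x hx
    simpa using (hx.smul_const (f x)).sub_const (c₀ x • f x)

variable [InnerProductSpace ℝ F]

lemma inner_toLp_eq_integral {u v : α → F} (hu : MemLp u 2 μ) (hv : MemLp v 2 μ) :
    ⟪hu.toLp u, hv.toLp v⟫ = ∫ x, ⟪u x, v x⟫ ∂μ := by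
  rw [L2.inner_def]
  refine integral_congr_ae ?_
  filter_upwards [hu.coeFn_toLp, hv.coeFn_toLp] with x hux hvx
  rw [hux, hvx]

lemma integrable_inner_of_memLp_two {u v : α → F} (hu : MemLp u 2 μ) (hv : MemLp v 2 μ) :
    Integrable (fun x => ⟪u x, v x⟫) μ := by
  refine (L2.integrable_inner (𝕜 := ℝ) (hu.toLp u) (hv.toLp v)).congr ?_
  filter_upwards [hu.coeFn_toLp, hv.coeFn_toLp] with x hux hvx
  rw [hux, hvx]

lemma tendsto_integral_inner_of_tendsto_eLpNorm {f g : ℕ → α → F} {f₀ g₀ : α → F}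
    (hf : ∀ n, MemLp (f n) 2 μ) (hg : ∀ n, MemLp (g n) 2 μ) (hf₀ : MemLp f₀ 2 μ)
    (hg₀ : MemLp g₀ 2 μ) (hfl : Tendsto (fun n => eLpNorm (f n - f₀) 2 μ) atTop (𝓝 0))
    (hgl : Tendsto (fun n => eLpNorm (g n - g₀) 2 μ) atTop (𝓝 0)) :
    Tendsto (fun n => ∫ x, ⟪f n x, g n x⟫ ∂μ) atTop (𝓝 (∫ x, ⟪f₀ x, g₀ x⟫ ∂μ)) := by
  have hfLp := (Lp.tendsto_Lp_iff_tendsto_eLpNorm'' f hf f₀ hf₀).2 hfl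
  have hgLp := (Lp.tendsto_Lp_iff_tendsto_eLpNorm'' g hg g₀ hg₀).2 hgl
  simpa only [inner_toLp_eq_integral] using hfLp.inner hgLp (𝕜 := ℝ)

lemma tendsto_integral_mul_of_bounded {c : ℕ → α → ℝ} {c₀ f : α → ℝ} {C : ℝ}
    (hc : ∀ n, AEStronglyMeasurable (c n) μ) (hb : ∀ n, ∀ᵐ x ∂μ, |c n x| ≤ C)
    (hlim : ∀ᵐ x ∂μ, Tendsto (fun n => c n x) atTop (𝓝 (c₀ x))) (hf : Integrable f μ) :
    Tendsto (fun n => ∫ x, f x * c n x ∂μ) atTop (𝓝 (∫ x, f x * c₀ x ∂μ)) := by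
  refine tendsto_integral_of_dominated_convergence (fun x => |f x| * C)
    (fun n => hf.1.mul (hc n)) (hf.abs.mul_const C) (fun n => ?_) ?_
  · filter_upwards [hb n] with x hx
    rw [norm_mul, Real.norm_eq_abs, Real.norm_eq_abs]
    gcongr
  · filter_upwards [hlim] with x hx using hx.const_mul _

end Convergence

section TestCoefficient

variable {E F : Type*} [NormedAddCommGroup E] [NormedSpace ℝ E] [MeasurableSpace E]
  [OpensMeasurableSpace E] {μ : Measure E}
  [NormedAddCommGroup F] [InnerProductSpace ℝ F]
  {s : Set E} {φ v : E → ℝ} {r : ℝ → ℝ} {C : ℝ} {f g₀ : E → F}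

lemma IsTestFunction.memLp_mul_comp_smul (hφ : IsTestFunction s φ) (hr : Continuous r)
    (hrC : ∀ t, |r t| ≤ C) (hv : AEStronglyMeasurable v μ) (hf : MemLp f 2 μ) :
    MemLp (fun x => (φ x * r (v x)) • f x) 2 μ := by
  obtain ⟨B, hB⟩ := hφ.hasCompactSupport.exists_bound_of_continuous hφ.continuous
  refine hf.smul (memLp_top_of_bound (C := B * C)
    (hφ.continuous.aestronglyMeasurable.mul (hr.comp_aestronglyMeasurable hv))
    (.of_forall fun x => ?_))
  rw [norm_mul]
  exact mul_le_mul (hB x) (hrC _) (abs_nonneg _) ((norm_nonneg _).trans (hB x))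

lemma IsTestFunction.tendsto_integral_inner_mul_comp_smul {w : ℕ → E → ℝ} {g : ℕ → E → F}
    (hφ : IsTestFunction s φ) (hr : Continuous r) (hrC : ∀ t, |r t| ≤ C)
    (hw : ∀ n, AEStronglyMeasurable (w n) μ) (hv : AEStronglyMeasurable v μ)
    (hwv : ∀ᵐ x ∂μ, Tendsto (fun n => w n x) atTop (𝓝 (v x))) (hf : MemLp f 2 μ)
    (hg : ∀ n, MemLp (g n) 2 μ) (hg₀ : MemLp g₀ 2 μ)
    (hgl : Tendsto (fun n => eLpNorm (g n - g₀) 2 μ) atTop (𝓝 0)) :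
    Tendsto (fun n => ∫ x, ⟪(φ x * r (w n x)) • f x, g n x⟫ ∂μ) atTop
      (𝓝 (∫ x, ⟪(φ x * r (v x)) • f x, g₀ x⟫ ∂μ)) := by
  obtain ⟨B, hB⟩ := hφ.hasCompactSupport.exists_bound_of_continuous hφ.continuous
  have hφm : AEStronglyMeasurable φ μ := hφ.continuous.aestronglyMeasurable
  refine tendsto_integral_inner_of_tendsto_eLpNorm
    (fun n => hφ.memLp_mul_comp_smul hr hrC (hw n) hf) hg (hφ.memLp_mul_comp_smul hr hrC hv hf)
    hg₀ (tendsto_eLpNorm_smul_sub (C := B * C) two_ne_zero ENNReal.ofNat_ne_top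
      (fun n => hφm.mul (hr.comp_aestronglyMeasurable (hw n)))
      (hφm.mul (hr.comp_aestronglyMeasurable hv)) (fun n x => ?_) ?_ hf) hgl
  · exact (abs_mul (φ x) _).trans_le
      (mul_le_mul (hB x) (hrC _) (abs_nonneg _) ((norm_nonneg _).trans (hB x)))
  · filter_upwards [hwv] with x hx using ((hr.tendsto _).comp hx).const_mul _

end TestCoefficient

section Potential

variable {N : ℕ} {f : Sph N → ℝ}

lemma angular_of_ne_zero (f : Sph N → ℝ) {x : RN N} (hx : x ≠ 0) :
    angular f x = f ⟨‖x‖⁻¹ • x, by simp [norm_smul, hx]⟩ := by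
  simp [angular, hx]

lemma angular_smul_right (f : Sph N → ℝ) {r : ℝ} (hr : 0 < r) (x : RN N) :
    angular f (r • x) = angular f x := by
  rcases eq_or_ne x 0 with rfl | hx
  · rw [smul_zero]
  · rw [angular_of_ne_zero f hx, angular_of_ne_zero f (smul_ne_zero hr.ne' hx)]
    congr 2
    rw [norm_smul, Real.norm_of_nonneg hr.le, mul_inv_rev, mul_smul, inv_smul_smul₀ hr.ne']

lemma angular_coe (f : Sph N → ℝ) (θ : Sph N) : angular f θ = f θ := by
  have hθ : ‖(θ : RN N)‖ = 1 := norm_eq_of_mem_sphere θ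
  rw [angular_of_ne_zero f (norm_ne_zero_iff.1 (by simp [hθ]))]
  congr 1
  ext1
  simp [hθ]

lemma angular_smul_coe (f : Sph N → ℝ) {r : ℝ} (hr : 0 < r) (θ : Sph N) :
    angular f (r • (θ : RN N)) = f θ := by
  rw [angular_smul_right f hr, angular_coe]

lemma continuousOn_angular (hf : Continuous f) : ContinuousOn (angular f) {0}ᶜ := by
  rw [continuousOn_iff_continuous_domRestrict]
  have hmem : ∀ x : ({0}ᶜ : Set (RN N)), ‖(x : RN N)‖⁻¹ • (x : RN N) ∈ sphere (0 : RN N) 1 :=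
    fun x => by simp [norm_smul, show (x : RN N) ≠ 0 from x.2]
  have hcont : Continuous fun x : ({0}ᶜ : Set (RN N)) => ‖(x : RN N)‖⁻¹ • (x : RN N) :=
    (continuous_subtype_val.norm.inv₀ fun x => norm_ne_zero_iff.2 x.2).smul continuous_subtype_val
  exact (hf.comp (hcont.subtype_mk hmem)).congr fun x => (angular_of_ne_zero f x.2).symm

lemma abs_angular_le {M : ℝ} (hM : ∀ θ, |f θ| ≤ M) (hM0 : 0 ≤ M) (x : RN N) :
    |angular f x| ≤ M := by
  rcases eq_or_ne x 0 with rfl | hx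
  · simp [angular, hM0]
  · rw [angular_of_ne_zero f hx]
    exact hM _

lemma exists_abs_le_of_continuous {X : Type*} [TopologicalSpace X] [CompactSpace X] {f : X → ℝ}
    (hf : Continuous f) : ∃ M, 0 ≤ M ∧ ∀ x, |f x| ≤ M := by
  obtain ⟨M, hM⟩ := isCompact_univ.exists_bound_of_continuousOn hf.continuousOn
  exact ⟨max M 0, le_max_right _ _, fun x => (hM x trivial).trans (le_max_left _ _)⟩

lemma continuousOn_inv_normSq_sub (a : RN N) :
    ContinuousOn (fun x => (‖x - a‖ ^ 2)⁻¹) {a}ᶜ :=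
  ContinuousOn.inv₀ (by fun_prop) fun x hx => by simpa [sub_eq_zero] using hx

lemma continuousOn_polePotential (hf : Continuous f) (a : RN N) :
    ContinuousOn (polePotential f a) {a}ᶜ := by
  have hmaps : Set.MapsTo (fun x : RN N => x - a) {a}ᶜ {0}ᶜ := fun x hx => by
    simpa [sub_eq_zero] using hx
  exact ((continuousOn_angular hf).comp (by fun_prop) hmaps).div₀ (by fun_prop)
    fun x hx => by simpa [sub_eq_zero] using hx

lemma abs_polePotential_le {M : ℝ} (hM : ∀ θ, |f θ| ≤ M) (hM0 : 0 ≤ M) (a x : RN N) :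
    |polePotential f a x| ≤ M * (‖x - a‖ ^ 2)⁻¹ := by
  rw [polePotential, abs_div, div_eq_mul_inv, abs_of_nonneg (by positivity : 0 ≤ ‖x - a‖ ^ 2)]
  gcongr
  exact abs_angular_le hM hM0 _

end Potential

section RadialHardy

lemma integral_fderiv_self_eq_neg_finrank_mul {E : Type*} [NormedAddCommGroup E] [NormedSpace ℝ E]
    [FiniteDimensional ℝ E] [MeasurableSpace E] [BorelSpace E] {μ : Measure E} [μ.IsAddHaarMeasure]
    {g : E → ℝ} (hg : ContDiff ℝ 1 g) (hc : HasCompactSupport g) :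
    ∫ x, fderiv ℝ g x x ∂μ = -(Module.finrank ℝ E : ℝ) * ∫ x, g x ∂μ := by
  let b := Module.finBasis ℝ E
  let coord : Fin (Module.finrank ℝ E) → E →L[ℝ] ℝ := fun i => (b.coord i).toContinuousLinearMap
  have hcont_fderiv : ∀ i, Continuous fun x => fderiv ℝ g x (b i) := fun i =>
    (hg.continuous_fderiv one_ne_zero).clm_apply continuous_const
  have hexpand : ∀ x, fderiv ℝ g x x = ∑ i, coord i x * fderiv ℝ g x (b i) := fun x => by
    conv_lhs => enter [2]; rw [← b.sum_repr x]
    simp only [map_sum, map_smul, smul_eq_mul]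
    rfl
  have hint : ∀ i, Integrable (fun x => coord i x * fderiv ℝ g x (b i)) μ := fun i =>
    ((coord i).continuous.mul (hcont_fderiv i)).integrable_of_hasCompactSupport
      (hc.fderiv_apply (𝕜 := ℝ) _).mul_left
  have hfderiv_coord : ∀ i x, fderiv ℝ (coord i) x (b i) = 1 := fun i x => by
    rw [(coord i).fderiv]
    simp [coord]
  have hparts : ∀ i, ∫ x, coord i x * fderiv ℝ g x (b i) ∂μ = -∫ x, g x ∂μ := fun i => by
    rw [integral_mul_fderiv_eq_neg_fderiv_mul_of_integrable _ (hint i) _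
      (fun x _ => (coord i).differentiableAt) (fun x _ => hg.differentiable one_ne_zero x)]
    · simp only [hfderiv_coord, one_mul]
    · simpa only [hfderiv_coord, one_mul] using hg.continuous.integrable_of_hasCompactSupport hc
    · exact ((coord i).continuous.mul hg.continuous).integrable_of_hasCompactSupport hc.mul_left
  simp only [hexpand, integral_finsetSum _ fun i _ => hint i, hparts, Finset.sum_const,
    Finset.card_univ, Fintype.card_fin, nsmul_eq_mul, mul_neg, neg_mul]

variable {N : ℕ} {φ : RN N → ℝ}

lemma contDiffOn_inv_normSq {E : Type*} [NormedAddCommGroup E] [InnerProductSpace ℝ E] :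
    ContDiffOn ℝ ∞ (fun x : E => (‖x‖ ^ 2)⁻¹) {0}ᶜ :=
  (contDiff_norm_sq ℝ).contDiffOn.inv fun x hx => by simpa using hx

lemma IsTestFunction.integrable_inv_normSq_mul_inner_sq (hφ : IsTestFunction {0} φ) :
    Integrable (fun x => (‖x‖ ^ 2)⁻¹ * ⟪gradient φ x, x⟫ ^ 2) :=
  hφ.integrable_mul isClosed_singleton contDiffOn_inv_normSq.continuousOn
    (((continuous_gradient hφ.contDiff_one).inner continuous_id).pow 2)
    fun x hx => support_gradient_subset φ fun h0 => hx (by simp [h0])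

lemma IsTestFunction.integrable_inv_normSq_mul_inner (hφ : IsTestFunction {0} φ) :
    Integrable (fun x => (‖x‖ ^ 2)⁻¹ * (φ x * ⟪gradient φ x, x⟫)) :=
  hφ.integrable_mul isClosed_singleton contDiffOn_inv_normSq.continuousOn
    (hφ.continuous.mul ((continuous_gradient hφ.contDiff_one).inner continuous_id))
    fun x hx => support_gradient_subset φ fun h0 => hx (by simp [h0])

lemma IsTestFunction.fderiv_inv_normSq_mul_sq_self (hφ : IsTestFunction {0} φ) (x : RN N) :
    fderiv ℝ (fun y => (‖y‖ ^ 2)⁻¹ * φ y ^ 2) x x =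
      2 * ((‖x‖ ^ 2)⁻¹ * (φ x * ⟪gradient φ x, x⟫)) - 2 * ((‖x‖ ^ 2)⁻¹ * φ x ^ 2) := by
  rcases eq_or_ne x 0 with rfl | hx
  · simp
  have hφx := (hφ.differentiable x).hasFDerivAt
  have hinv := (hasDerivAt_inv (by positivity : ‖x‖ ^ 2 ≠ 0)).comp_hasFDerivAt x
    (hasStrictFDerivAt_norm_sq x).hasFDerivAt
  have hderiv := hinv.mul (hφx.pow 2)
  rw [HasFDerivAt.fderiv (by exact hderiv), inner_gradient_left]
  simp only [add_apply, smul_apply, smul_eq_mul, Function.comp_apply, innerSL_apply_apply,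
    nsmul_eq_mul, Nat.cast_ofNat, real_inner_self_eq_norm_sq, Nat.add_one_sub_one, pow_one]
  field_simp
  ring

/-- The divergence theorem for the vector field `φ² x / |x|²`. -/
lemma IsTestFunction.two_mul_integral_inv_normSq_mul_inner (hφ : IsTestFunction {0} φ) :
    2 * ∫ x, (‖x‖ ^ 2)⁻¹ * (φ x * ⟪gradient φ x, x⟫) =
      -((N : ℝ) - 2) * ∫ x, (‖x‖ ^ 2)⁻¹ * φ x ^ 2 := by
  have htest := hφ.sq.mul_left_of_contDiffOn isClosed_singleton contDiffOn_inv_normSq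
  have hdiv := integral_fderiv_self_eq_neg_finrank_mul (μ := volume) htest.contDiff_one
    htest.hasCompactSupport
  simp only [hφ.fderiv_inv_normSq_mul_sq_self, finrank_euclideanSpace_fin] at hdiv
  rw [integral_sub (hφ.integrable_inv_normSq_mul_inner.const_mul 2)
    ((hφ.integrable_mul_sq isClosed_singleton contDiffOn_inv_normSq.continuousOn).const_mul 2),
    integral_const_mul, integral_const_mul] at hdiv
  linarith

lemma hardy_radial (hφ : IsTestFunction {0} φ) :
    (((N : ℝ) - 2) / 2) ^ 2 * ∫ x, (‖x‖ ^ 2)⁻¹ * φ x ^ 2 ≤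
      ∫ x, (‖x‖ ^ 2)⁻¹ * ⟪gradient φ x, x⟫ ^ 2 := by
  obtain ⟨c, hc⟩ : ∃ c : ℝ, c = ((N : ℝ) - 2) / 2 := ⟨_, rfl⟩
  rw [← hc]
  have hsq : Integrable (fun x => (‖x‖ ^ 2)⁻¹ * φ x ^ 2) :=
    hφ.integrable_mul_sq isClosed_singleton contDiffOn_inv_normSq.continuousOn
  have hinner := hφ.integrable_inv_normSq_mul_inner
  have hinner_sq := hφ.integrable_inv_normSq_mul_inner_sq
  have hnonneg : 0 ≤ ∫ x, (‖x‖ ^ 2)⁻¹ * (⟪gradient φ x, x⟫ + c * φ x) ^ 2 :=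
    integral_nonneg fun x => by positivity
  have hexpand : ∀ x, (‖x‖ ^ 2)⁻¹ * (⟪gradient φ x, x⟫ + c * φ x) ^ 2 =
      (‖x‖ ^ 2)⁻¹ * ⟪gradient φ x, x⟫ ^ 2 +
        2 * c * ((‖x‖ ^ 2)⁻¹ * (φ x * ⟪gradient φ x, x⟫)) + c ^ 2 * ((‖x‖ ^ 2)⁻¹ * φ x ^ 2) :=
    fun x => by ring
  simp only [hexpand] at hnonneg
  rw [integral_add (by exact hinner_sq.add (hinner.const_mul _)) (hsq.const_mul _),
    integral_add hinner_sq (hinner.const_mul _), integral_const_mul, integral_const_mul] at hnonneg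
  have hdiv := hφ.two_mul_integral_inv_normSq_mul_inner
  rw [show -((N : ℝ) - 2) = -(2 * c) by rw [hc]; ring] at hdiv
  linear_combination hnonneg + c * hdiv

end RadialHardy

section Sphere

variable {N : ℕ}

instance isFiniteMeasure_surfaceMeasure (N : ℕ) : IsFiniteMeasure (surfaceMeasure N) := by
  unfold surfaceMeasure
  infer_instance

lemma memLp_of_continuous_of_compactSpace {X F : Type*} [TopologicalSpace X] [CompactSpace X]
    [MeasurableSpace X] [OpensMeasurableSpace X] {μ : Measure X} [IsFiniteMeasure μ]
    [NormedAddCommGroup F] [SecondCountableTopology F] {f : X → F} (hf : Continuous f)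
    (p : ENNReal) : MemLp f p μ :=
  hf.memLp_of_hasCompactSupport (HasCompactSupport.of_compactSpace f)

lemma integrable_of_continuous_of_compactSpace {X : Type*} [TopologicalSpace X] [CompactSpace X]
    [MeasurableSpace X] [OpensMeasurableSpace X] {μ : Measure X} [IsFiniteMeasure μ] {f : X → ℝ}
    (hf : Continuous f) : Integrable f μ :=
  hf.integrable_of_hasCompactSupport (HasCompactSupport.of_compactSpace f)

lemma integral_sq_pos {α : Type*} [MeasurableSpace α] {μ : Measure α} {f : α → ℝ}
    (hf : Integrable (fun x => f x ^ 2) μ) (hne : ¬ f =ᵐ[μ] 0) : 0 < ∫ x, f x ^ 2 ∂μ := by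
  refine lt_of_le_of_ne (integral_nonneg fun x => sq_nonneg _) fun h0 => hne ?_
  rw [eq_comm, integral_eq_zero_iff_of_nonneg (fun x => sq_nonneg _) hf] at h0
  filter_upwards [h0] with x hx
  exact pow_eq_zero_iff two_ne_zero |>.1 hx

lemma hasFDerivAt_inv_norm_smul_self {E : Type*} [NormedAddCommGroup E] [InnerProductSpace ℝ E]
    {θ : E} (hθ : ‖θ‖ = 1) :
    HasFDerivAt (fun x : E => ‖x‖⁻¹ • x)
      (ContinuousLinearMap.id ℝ E - (innerSL ℝ θ).smulRight θ) θ := by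
  have hnorm : HasFDerivAt (fun x : E => ‖x‖) (innerSL ℝ θ) θ := by
    have hsqrt := (hasStrictFDerivAt_norm_sq θ).hasFDerivAt.sqrt (by simp [hθ])
    simp only [Real.sqrt_sq (norm_nonneg _)] at hsqrt
    exact hsqrt.congr_fderiv (by ext v; simp [hθ])
  have hinv : HasFDerivAt (fun x : E => ‖x‖⁻¹) (-innerSL ℝ θ) θ :=
    ((hasDerivAt_inv (by simp [hθ])).comp_hasFDerivAt _ hnorm).congr_fderiv (by ext v; simp [hθ])
  refine (hinv.smul (hasFDerivAt_id _)).congr_fderiv ?_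
  ext v
  simp [hθ, sub_eq_add_neg]

/-- The right-hand side is `r` times the tangential part of `∇φ` at `r θ`. -/
lemma sphereGrad_comp_smul {φ : RN N → ℝ} (hφ : Differentiable ℝ φ) (r : ℝ) (θ : Sph N) :
    sphereGrad (fun θ : Sph N => φ (r • (θ : RN N))) θ =
      r • (gradient φ (r • (θ : RN N)) -
        ⟪gradient φ (r • (θ : RN N)), (θ : RN N)⟫ • (θ : RN N)) := by
  have hθ : ‖(θ : RN N)‖ = 1 := norm_eq_of_mem_sphere θ
  have hθ0 : (θ : RN N) ≠ 0 := norm_ne_zero_iff.1 (by simp [hθ])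
  have hangular : angular (fun θ : Sph N => φ (r • (θ : RN N))) =ᶠ[𝓝 (θ : RN N)]
      fun x => φ (r • (‖x‖⁻¹ • x)) := by
    filter_upwards [isOpen_ne.mem_nhds hθ0] with x hx
    rw [angular_of_ne_zero _ hx]
  have hφθ : HasFDerivAt φ (fderiv ℝ φ (r • (θ : RN N))) (r • (‖(θ : RN N)‖⁻¹ • (θ : RN N))) := by
    simpa only [hθ, inv_one, one_smul] using (hφ _).hasFDerivAt
  have hcomp := hφθ.comp (θ : RN N) ((hasFDerivAt_inv_norm_smul_self hθ).const_smul r)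
  refine ext_inner_right ℝ fun v => ?_
  rw [sphereGrad, hangular.gradient_eq, inner_gradient_left, HasFDerivAt.fderiv (by exact hcomp),
    inner_smul_left, inner_sub_left, inner_smul_left, inner_gradient_left, inner_gradient_left]
  simp only [ContinuousLinearMap.comp_apply, smul_apply, sub_apply, ContinuousLinearMap.id_apply,
    ContinuousLinearMap.smulRight_apply, innerSL_apply_apply, map_smul, map_sub, smul_eq_mul,
    conj_trivial]
  ring

lemma norm_sub_inner_smul_sq {E : Type*} [NormedAddCommGroup E] [InnerProductSpace ℝ E] {w θ : E}
    (hθ : ‖θ‖ = 1) : ‖w - ⟪w, θ⟫ • θ‖ ^ 2 = ‖w‖ ^ 2 - ⟪w, θ⟫ ^ 2 := by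
  rw [norm_sub_sq_real, inner_smul_right, norm_smul, hθ, mul_one, Real.norm_eq_abs, sq_abs]
  ring

lemma continuous_sphereGrad_comp_smul {φ : RN N → ℝ} (hφ : ContDiff ℝ 1 φ) (r : ℝ) :
    Continuous (sphereGrad fun θ : Sph N => φ (r • (θ : RN N))) := by
  rw [funext (sphereGrad_comp_smul (hφ.differentiable one_ne_zero) r)]
  have hgrad : Continuous fun θ : Sph N => gradient φ (r • (θ : RN N)) :=
    (continuous_gradient hφ).comp (continuous_subtype_val.const_smul r)
  exact (hgrad.sub
    ((hgrad.inner (𝕜 := ℝ) continuous_subtype_val).smul continuous_subtype_val)).const_smul r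

variable [Fact (3 ≤ N)]

lemma sphereContDiff_comp_smul {φ : RN N → ℝ} (hφ : ContDiff ℝ ∞ φ) (r : ℝ) :
    SphereContDiff ⊤ (fun θ : Sph N => φ (r • (θ : RN N))) :=
  (hφ.comp (contDiff_id.const_smul r)).contMDiff.comp (contMDiff_coe_sphere (m := ∞))

lemma hasH1SphereGrad_sphereGrad {ψ : Sph N → ℝ} (hψ : SphereContDiff ⊤ ψ)
    (hg : Continuous (sphereGrad ψ)) : HasH1SphereGrad ψ (sphereGrad ψ) :=
  ⟨memLp_of_continuous_of_compactSpace hψ.continuous 2, memLp_of_continuous_of_compactSpace hg 2,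
    fun _ => ψ, fun _ => hψ, by simp, by simp⟩

lemma bddBelow_rayleigh {h : Sph N → ℝ} (hh : Continuous h) :
    BddBelow {t : ℝ | ∃ (ψ : Sph N → ℝ) (G : Sph N → RN N),
      HasH1SphereGrad ψ G ∧ ¬ ψ =ᵐ[surfaceMeasure N] 0 ∧
      t = ((∫ θ, ‖G θ‖ ^ 2 ∂surfaceMeasure N) - ∫ θ, h θ * ψ θ ^ 2 ∂surfaceMeasure N) /
        ∫ θ, ψ θ ^ 2 ∂surfaceMeasure N} := by
  obtain ⟨M, -, hM⟩ := exists_abs_le_of_continuous hh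
  refine ⟨-M, ?_⟩
  rintro t ⟨ψ, G, hψG, hne, rfl⟩
  have hψ2 : Integrable (fun θ => ψ θ ^ 2) (surfaceMeasure N) := hψG.1.integrable_sq
  rw [le_div_iff₀ (integral_sq_pos hψ2 hne)]
  have hpot : ∫ θ, h θ * ψ θ ^ 2 ∂surfaceMeasure N ≤ M * ∫ θ, ψ θ ^ 2 ∂surfaceMeasure N := by
    rw [← integral_const_mul]
    exact integral_mono (hψ2.bdd_mul hh.aestronglyMeasurable (c := M) (.of_forall hM))
      (hψ2.const_mul _) fun θ =>
        mul_le_mul_of_nonneg_right ((le_abs_self _).trans (hM θ)) (sq_nonneg _)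
  have hgrad : 0 ≤ ∫ θ, ‖G θ‖ ^ 2 ∂surfaceMeasure N := integral_nonneg fun θ => sq_nonneg _
  linarith

lemma sphereFirstEigenvalue_mul_le {h ψ : Sph N → ℝ} {G : Sph N → RN N} (hh : Continuous h)
    (hψG : HasH1SphereGrad ψ G) :
    sphereFirstEigenvalue h * ∫ θ, ψ θ ^ 2 ∂surfaceMeasure N ≤
      (∫ θ, ‖G θ‖ ^ 2 ∂surfaceMeasure N) - ∫ θ, h θ * ψ θ ^ 2 ∂surfaceMeasure N := by
  by_cases hψ0 : ψ =ᵐ[surfaceMeasure N] 0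
  · have hsq : ∫ θ, ψ θ ^ 2 ∂surfaceMeasure N = 0 :=
      integral_eq_zero_of_ae (by filter_upwards [hψ0] with θ hθ; simp [hθ])
    have hpot : ∫ θ, h θ * ψ θ ^ 2 ∂surfaceMeasure N = 0 :=
      integral_eq_zero_of_ae (by filter_upwards [hψ0] with θ hθ; simp [hθ])
    rw [hsq, hpot, mul_zero, sub_zero]
    exact integral_nonneg fun θ => sq_nonneg _
  · rw [← le_div_iff₀ (integral_sq_pos hψG.1.integrable_sq hψ0)]
    exact csInf_le (bddBelow_rayleigh hh) ⟨ψ, G, hψG, hψ0, rfl⟩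

end Sphere

section Polar

variable {E : Type*} [NormedAddCommGroup E] [NormedSpace ℝ E] [FiniteDimensional ℝ E]
  [MeasurableSpace E] [BorelSpace E] {μ : Measure E} [μ.IsAddHaarMeasure]

lemma integrable_toSphere_prod {F : E → ℝ} (hF : Integrable F μ) :
    Integrable (fun p : sphere (0 : E) 1 × Set.Ioi (0 : ℝ) => F ((p.2 : ℝ) • (p.1 : E)))
      (μ.toSphere.prod (.volumeIoiPow (Module.finrank ℝ E - 1))) := by
  rw [← μ.measurePreserving_homeomorphUnitSphereProd.integrable_comp_emb
    (homeomorphUnitSphereProd E).measurableEmbedding]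
  refine ((integrableOn_iff_comap_subtypeVal (measurableSet_singleton _).compl).1
    (hF.integrableOn (s := {0}ᶜ))).congr (.of_forall fun x => ?_)
  simp [smul_smul, mul_inv_cancel₀ (norm_ne_zero_iff.2 x.2)]

variable [Nontrivial E]

lemma integral_eq_integral_toSphere_prod (F : E → ℝ) :
    ∫ x, F x ∂μ = ∫ p : sphere (0 : E) 1 × Set.Ioi (0 : ℝ), F ((p.2 : ℝ) • (p.1 : E))
      ∂(μ.toSphere.prod (.volumeIoiPow (Module.finrank ℝ E - 1))) := by
  rw [← μ.measurePreserving_homeomorphUnitSphereProd.integral_comp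
    (homeomorphUnitSphereProd E).measurableEmbedding,
    ← setIntegral_univ, ← setIntegral_congr_set (ae_eq_univ.2 (by simp) : ({0}ᶜ : Set E) =ᵐ[μ] _),
    ← integral_subtype_comap (measurableSet_singleton _).compl]
  refine integral_congr_ae (.of_forall fun x => ?_)
  simp [smul_smul, mul_inv_cancel₀ (norm_ne_zero_iff.2 x.2)]

lemma integral_nonneg_of_integral_toSphere_nonneg {F : E → ℝ} (hF : Integrable F μ)
    (h : ∀ r : ℝ, 0 < r → 0 ≤ ∫ θ : sphere (0 : E) 1, F (r • (θ : E)) ∂μ.toSphere) :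
    0 ≤ ∫ x, F x ∂μ := by
  rw [integral_eq_integral_toSphere_prod, integral_prod_symm _ (integrable_toSphere_prod hF)]
  exact integral_nonneg fun r => h r r.2

end Polar

section Hardy

variable {N : ℕ} [Fact (3 ≤ N)] {h : Sph N → ℝ} {φ : RN N → ℝ}

lemma nontrivial_RN (N : ℕ) [hN : Fact (3 ≤ N)] : Nontrivial (RN N) :=
  haveI : Nonempty (Fin N) := ⟨⟨0, by have := hN.out; omega⟩⟩
  inferInstance

lemma integral_sphere_hardy_nonneg (hh : Continuous h) (hφ : IsTestFunction {0} φ) {r : ℝ}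
    (hr : 0 < r) :
    0 ≤ ∫ θ : Sph N, (‖gradient φ (r • (θ : RN N))‖ ^ 2 -
        (‖r • (θ : RN N)‖ ^ 2)⁻¹ * ⟪gradient φ (r • (θ : RN N)), r • (θ : RN N)⟫ ^ 2 -
      (sphereFirstEigenvalue h * ((‖r • (θ : RN N)‖ ^ 2)⁻¹ * φ (r • (θ : RN N)) ^ 2) +
        polePotential h 0 (r • (θ : RN N)) * φ (r • (θ : RN N)) ^ 2)) ∂surfaceMeasure N := by
  set m := sphereFirstEigenvalue h
  set ψ : Sph N → ℝ := fun θ => φ (r • (θ : RN N)) with hψ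
  have hψc : Continuous ψ := hφ.continuous.comp (continuous_subtype_val.const_smul r)
  have hgradc : Continuous (sphereGrad ψ) := continuous_sphereGrad_comp_smul hφ.contDiff_one r
  have hrayleigh := sphereFirstEigenvalue_mul_le hh
    (hasH1SphereGrad_sphereGrad (sphereContDiff_comp_smul hφ.contDiff r) hgradc)
  have hpointwise : ∀ θ : Sph N, (‖gradient φ (r • (θ : RN N))‖ ^ 2 -
      (‖r • (θ : RN N)‖ ^ 2)⁻¹ * ⟪gradient φ (r • (θ : RN N)), r • (θ : RN N)⟫ ^ 2 -
      (m * ((‖r • (θ : RN N)‖ ^ 2)⁻¹ * φ (r • (θ : RN N)) ^ 2) +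
        polePotential h 0 (r • (θ : RN N)) * φ (r • (θ : RN N)) ^ 2)) =
      (r ^ 2)⁻¹ * (‖sphereGrad ψ θ‖ ^ 2 - h θ * ψ θ ^ 2 - m * ψ θ ^ 2) := fun θ => by
    have hθ : ‖(θ : RN N)‖ = 1 := norm_eq_of_mem_sphere θ
    rw [sphereGrad_comp_smul hφ.differentiable, polePotential, sub_zero, angular_smul_coe h hr]
    simp only [norm_smul, hθ, Real.norm_eq_abs, mul_one, sq_abs, mul_pow,
      norm_sub_inner_smul_sq hθ, inner_smul_right, hψ]
    field_simp
    ring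
  simp only [hpointwise]
  rw [integral_const_mul, integral_sub, integral_sub, integral_const_mul]
  · exact mul_nonneg (by positivity) (sub_nonneg.2 hrayleigh)
  all_goals exact integrable_of_continuous_of_compactSpace (by fun_prop)

lemma hardy_angular (hh : Continuous h) (hφ : IsTestFunction {0} φ) :
    sphereFirstEigenvalue h * (∫ x, (‖x‖ ^ 2)⁻¹ * φ x ^ 2) +
        (∫ x, polePotential h 0 x * φ x ^ 2) ≤
      (∫ x, ‖gradient φ x‖ ^ 2) - ∫ x, (‖x‖ ^ 2)⁻¹ * ⟪gradient φ x, x⟫ ^ 2 := by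
  have := nontrivial_RN N
  have hsq : Integrable fun x => sphereFirstEigenvalue h * ((‖x‖ ^ 2)⁻¹ * φ x ^ 2) :=
    (hφ.integrable_mul_sq isClosed_singleton contDiffOn_inv_normSq.continuousOn).const_mul _
  have hpot : Integrable fun x => polePotential h 0 x * φ x ^ 2 :=
    hφ.integrable_mul_sq isClosed_singleton (continuousOn_polePotential hh 0)
  have hgrad : Integrable fun x => ‖gradient φ x‖ ^ 2 :=
    integrable_normSq_gradient hφ.contDiff_one hφ.hasCompactSupport
  have hradial := hφ.integrable_inv_normSq_mul_inner_sq
  rw [← integral_const_mul, ← integral_add hsq hpot, ← integral_sub hgrad hradial, ← sub_nonneg,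
    ← integral_sub (by exact hgrad.sub hradial) (by exact hsq.add hpot)]
  exact integral_nonneg_of_integral_toSphere_nonneg ((hgrad.sub hradial).sub (hsq.add hpot))
    fun r hr => integral_sphere_hardy_nonneg hh hφ hr

lemma hardy_at (hh : Continuous h) {a : RN N} (hφ : IsTestFunction {a} φ) :
    (sphereFirstEigenvalue h + (((N : ℝ) - 2) / 2) ^ 2) * (∫ x, (‖x - a‖ ^ 2)⁻¹ * φ x ^ 2) ≤
      (∫ x, ‖gradient φ x‖ ^ 2) - ∫ x, polePotential h a x * φ x ^ 2 := by
  have htranslate : IsTestFunction {0} (fun x => φ (x + a)) :=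
    (hφ.comp_add_right a).mono (by simp)
  have hangular := hardy_angular hh htranslate
  have hradial := hardy_radial htranslate
  simp only [gradient_comp_add_right] at hangular hradial
  rw [← integral_add_right_eq_self (fun x => (‖x - a‖ ^ 2)⁻¹ * φ x ^ 2) a,
    ← integral_add_right_eq_self (fun x => ‖gradient φ x‖ ^ 2) a,
    ← integral_add_right_eq_self (fun x => polePotential h a x * φ x ^ 2) a]
  simp only [polePotential, sub_zero, add_sub_cancel_right] at hangular hradial ⊢
  linarith

lemma exists_hardy_gap (hh : Continuous h)
    (hμ : sphereFirstEigenvalue h > -((((N : ℝ) - 2) / 2) ^ 2)) (a : RN N) :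
    ∃ δ : ℝ, 0 < δ ∧ ∀ φ : RN N → ℝ, IsTestFunction {a} φ →
      (∫ x, polePotential h a x * φ x ^ 2) + δ * (∫ x, (‖x - a‖ ^ 2)⁻¹ * φ x ^ 2) ≤
        (1 - δ) * ∫ x, ‖gradient φ x‖ ^ 2 := by
  obtain ⟨M, hM0, hM⟩ := exists_abs_le_of_continuous hh
  set γ := sphereFirstEigenvalue h + (((N : ℝ) - 2) / 2) ^ 2 with hγ
  have hγ0 : 0 < γ := by rw [hγ]; linarith
  refine ⟨γ / (γ + M + 1), by positivity, fun φ hφ => ?_⟩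
  have hhardy := hardy_at hh hφ
  have hpot_le : ∫ x, polePotential h a x * φ x ^ 2 ≤ M * ∫ x, (‖x - a‖ ^ 2)⁻¹ * φ x ^ 2 := by
    rw [← integral_const_mul]
    refine integral_mono (hφ.integrable_mul_sq isClosed_singleton (continuousOn_polePotential hh a))
      ((hφ.integrable_mul_sq isClosed_singleton (continuousOn_inv_normSq_sub a)).const_mul M)
      fun x => ?_
    rw [← mul_assoc]
    exact mul_le_mul_of_nonneg_right
      ((le_abs_self _).trans (abs_polePotential_le hM hM0 a x)) (sq_nonneg _)
  rw [← hγ] at hhardy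
  set P := ∫ x, polePotential h a x * φ x ^ 2
  set H := ∫ x, (‖x - a‖ ^ 2)⁻¹ * φ x ^ 2
  set D := ∫ x, ‖gradient φ x‖ ^ 2
  have hcombined : γ * (H + D) ≤ (D - P) * (γ + M + 1) := by nlinarith
  have hgap : γ / (γ + M + 1) * (H + D) ≤ D - P := by
    rwa [div_mul_eq_mul_div, div_le_iff₀ (by positivity)]
  linarith

end Hardy

section Indicator

variable {α : Type*} [MeasurableSpace α] {μ : Measure α} {f : α → ℝ} {K : Set α}

lemma integral_indicator_one_mul (f : α → ℝ) (hK : MeasurableSet K) :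
    ∫ x, K.indicator 1 x * f x ∂μ = ∫ x in K, f x ∂μ := by
  rw [← integral_indicator hK]
  congr with x
  by_cases hx : x ∈ K <;> simp [hx]

lemma integrable_indicator_one_mul (hf : Integrable f μ) (hK : MeasurableSet K) :
    Integrable (fun x => K.indicator 1 x * f x) μ := by
  refine (hf.indicator hK).congr (.of_forall fun x => ?_)
  by_cases hx : x ∈ K <;> simp [hx]

end Indicator

section PotentialLocalization

variable {E : Type*} [NormedAddCommGroup E] [NormedSpace ℝ E] [MeasurableSpace E]
  [OpensMeasurableSpace E] {μ : Measure E} [IsFiniteMeasureOnCompacts μ] {J : Type*} [Fintype J]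
  {s K : Set E} {t : J → Set E} {V φ : E → ℝ} {W χ : J → E → ℝ} {B : ℝ}

lemma integral_potential_le_of_localization (hs : IsClosed s) (ht : ∀ j, IsClosed (t j))
    (hK : MeasurableSet K) (hV : ContinuousOn V sᶜ) (hW : ∀ j, ContinuousOn (W j) (t j)ᶜ)
    (hle : ∀ x, V x ≤ ∑ j, W j x * χ j x ^ 2 + B * K.indicator 1 x) (hφ : IsTestFunction s φ)
    (hχφ : ∀ j, IsTestFunction (t j) (fun x => χ j x * φ x)) :
    ∫ x, V x * φ x ^ 2 ∂μ ≤
      (∑ j, ∫ x, W j x * (χ j x * φ x) ^ 2 ∂μ) + B * ∫ x in K, φ x ^ 2 ∂μ := by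
  have hW_int : ∀ j, Integrable (fun x => W j x * (χ j x * φ x) ^ 2) μ := fun j =>
    (hχφ j).integrable_mul_sq (ht j) (hW j)
  have hK_int : Integrable (fun x => B * (K.indicator 1 x * φ x ^ 2)) μ :=
    (integrable_indicator_one_mul hφ.integrable_sq hK).const_mul B
  rw [← integral_finsetSum _ fun j _ => hW_int j, ← integral_indicator_one_mul _ hK,
    ← integral_const_mul, ← integral_add (integrable_finsetSum _ fun j _ => hW_int j) hK_int]
  refine integral_mono (hφ.integrable_mul_sq hs hV)
    ((integrable_finsetSum _ fun j _ => hW_int j).add hK_int) fun x => ?_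
  calc V x * φ x ^ 2 ≤ (∑ j, W j x * χ j x ^ 2 + B * K.indicator 1 x) * φ x ^ 2 := by
        gcongr
        exact hle x
    _ = ∑ j, W j x * (χ j x * φ x) ^ 2 + B * (K.indicator 1 x * φ x ^ 2) := by
        simp only [add_mul, Finset.sum_mul, mul_pow, mul_assoc]

end PotentialLocalization

section Localization

variable {E : Type*} [NormedAddCommGroup E] [InnerProductSpace ℝ E] [CompleteSpace E]

lemma norm_gradient_mul_sq_le {f g : E → ℝ} {x : E} (hf : DifferentiableAt ℝ f x)
    (hg : DifferentiableAt ℝ g x) {ε : ℝ} (hε : 0 < ε) :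
    ‖gradient (fun y => f y * g y) x‖ ^ 2 ≤
      (1 + ε) * (f x ^ 2 * ‖gradient g x‖ ^ 2) + (1 + ε⁻¹) * (‖gradient f x‖ ^ 2 * g x ^ 2) := by
  have normSq_smul : ∀ (c : ℝ) (v : E), ‖c • v‖ ^ 2 = c ^ 2 * ‖v‖ ^ 2 := fun c v => by
    rw [norm_smul, mul_pow, Real.norm_eq_abs, sq_abs]
  rw [gradient_mul hf hg, ← normSq_smul, mul_comm (‖gradient f x‖ ^ 2), ← normSq_smul]
  generalize f x • gradient g x = v, g x • gradient f x = w
  have hyoung : 2 * ‖v‖ * ‖w‖ ≤ ε * ‖v‖ ^ 2 + ε⁻¹ * ‖w‖ ^ 2 := by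
    have hsq : ε⁻¹ * (ε * ‖v‖ - ‖w‖) ^ 2 = ε * ‖v‖ ^ 2 - 2 * ‖v‖ * ‖w‖ + ε⁻¹ * ‖w‖ ^ 2 := by
      field_simp
      ring
    have hnonneg : 0 ≤ ε⁻¹ * (ε * ‖v‖ - ‖w‖) ^ 2 := by positivity
    linarith
  calc ‖v + w‖ ^ 2 ≤ (‖v‖ + ‖w‖) ^ 2 := by gcongr; exact norm_add_le v w
    _ = ‖v‖ ^ 2 + 2 * ‖v‖ * ‖w‖ + ‖w‖ ^ 2 := by ring
    _ ≤ (1 + ε) * ‖v‖ ^ 2 + (1 + ε⁻¹) * ‖w‖ ^ 2 := by linarith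

lemma exists_normSq_gradient_le_indicator {f : E → ℝ} (hf : ContDiff ℝ 1 f) {K : Set E}
    (hK : IsCompact K) (h0 : ∀ x ∉ K, gradient f x = 0) :
    ∃ L : ℝ, ∀ x, ‖gradient f x‖ ^ 2 ≤ L * K.indicator 1 x := by
  obtain ⟨L, hL⟩ := hK.exists_bound_of_continuousOn (continuous_gradient hf).continuousOn
  refine ⟨L ^ 2, fun x => ?_⟩
  by_cases hx : x ∈ K
  · simpa [hx] using pow_le_pow_left₀ (norm_nonneg _) (hL x hx) 2
  · simp [hx, h0 x hx]

variable [MeasurableSpace E] [BorelSpace E] {μ : Measure E} [IsFiniteMeasureOnCompacts μ]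
  {J : Type*} [Fintype J] {s K : Set E} {t : J → Set E} {V φ : E → ℝ} {W χ : J → E → ℝ}
  {B L δ ε : ℝ}

lemma sum_integral_normSq_gradient_mul_le (hK : MeasurableSet K) (hχ : ∀ j, Differentiable ℝ (χ j))
    (hsum : ∀ x, ∑ j, χ j x ^ 2 ≤ 1) (hgrad : ∀ j x, ‖gradient (χ j) x‖ ^ 2 ≤ L * K.indicator 1 x)
    (hφ : IsTestFunction s φ) (hχφ : ∀ j, IsTestFunction (t j) (fun x => χ j x * φ x))
    (hε : 0 < ε) :
    ∑ j, ∫ x, ‖gradient (fun y => χ j y * φ y) x‖ ^ 2 ∂μ ≤ (1 + ε) * (∫ x, ‖gradient φ x‖ ^ 2 ∂μ) +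
      (1 + ε⁻¹) * (Fintype.card J * L) * ∫ x in K, φ x ^ 2 ∂μ := by
  have hD_int : Integrable (fun x => (1 + ε) * ‖gradient φ x‖ ^ 2) μ :=
    (integrable_normSq_gradient hφ.contDiff_one hφ.hasCompactSupport).const_mul _
  have hK_int : Integrable
      (fun x => (1 + ε⁻¹) * (Fintype.card J * L) * (K.indicator 1 x * φ x ^ 2)) μ :=
    (integrable_indicator_one_mul hφ.integrable_sq hK).const_mul _
  have hDχ_int : ∀ j, Integrable (fun x => ‖gradient (fun y => χ j y * φ y) x‖ ^ 2) μ := fun j =>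
    integrable_normSq_gradient (hχφ j).contDiff_one (hχφ j).hasCompactSupport
  rw [← integral_finsetSum _ fun j _ => hDχ_int j, ← integral_indicator_one_mul _ hK,
    ← integral_const_mul, ← integral_const_mul, ← integral_add hD_int hK_int]
  refine integral_mono (integrable_finsetSum _ fun j _ => hDχ_int j) (hD_int.add hK_int)
    fun x => ?_
  calc ∑ j, ‖gradient (fun y => χ j y * φ y) x‖ ^ 2
      ≤ ∑ j, ((1 + ε) * (χ j x ^ 2 * ‖gradient φ x‖ ^ 2) +
          (1 + ε⁻¹) * (L * K.indicator 1 x * φ x ^ 2)) := by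
        gcongr with j
        refine (norm_gradient_mul_sq_le (hχ j x) (hφ.differentiable x) hε).trans ?_
        gcongr
        exact hgrad j x
    _ = (1 + ε) * ((∑ j, χ j x ^ 2) * ‖gradient φ x‖ ^ 2) +
          (1 + ε⁻¹) * (Fintype.card J * L) * (K.indicator 1 x * φ x ^ 2) := by
        rw [Finset.sum_add_distrib, ← Finset.mul_sum, ← Finset.sum_mul, Finset.sum_const,
          Finset.card_univ, nsmul_eq_mul]
        ring
    _ ≤ (1 + ε) * ‖gradient φ x‖ ^ 2 +
          (1 + ε⁻¹) * (Fintype.card J * L) * (K.indicator 1 x * φ x ^ 2) := by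
        gcongr
        exact mul_le_of_le_one_left (sq_nonneg _) (hsum x)

lemma exists_form_bound_of_localization (hs : IsClosed s) (ht : ∀ j, IsClosed (t j))
    (hK : MeasurableSet K) (hV : ContinuousOn V sᶜ) (hW : ∀ j, ContinuousOn (W j) (t j)ᶜ)
    (hle : ∀ x, V x ≤ ∑ j, W j x * χ j x ^ 2 + B * K.indicator 1 x)
    (hχ : ∀ j, Differentiable ℝ (χ j)) (hsum : ∀ x, ∑ j, χ j x ^ 2 ≤ 1)
    (hgrad : ∀ j x, ‖gradient (χ j) x‖ ^ 2 ≤ L * K.indicator 1 x)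
    (hχφ : ∀ j φ, IsTestFunction s φ → IsTestFunction (t j) (fun x => χ j x * φ x))
    (hδ0 : 0 < δ) (hδ1 : δ ≤ 1)
    (hform : ∀ j φ, IsTestFunction (t j) φ →
      ∫ x, W j x * φ x ^ 2 ∂μ ≤ (1 - δ) * ∫ x, ‖gradient φ x‖ ^ 2 ∂μ) :
    ∃ C : ℝ, ∀ φ, IsTestFunction s φ → ∫ x, V x * φ x ^ 2 ∂μ ≤
      (1 - δ / 2) * (∫ x, ‖gradient φ x‖ ^ 2 ∂μ) + C * ∫ x in K, φ x ^ 2 ∂μ := by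
  refine ⟨(1 - δ) * ((1 + (δ / 2)⁻¹) * (Fintype.card J * L)) + B, fun φ hφ => ?_⟩
  have hD0 : 0 ≤ ∫ x, ‖gradient φ x‖ ^ 2 ∂μ := integral_nonneg fun x => sq_nonneg _
  have : 0 ≤ 1 - δ := sub_nonneg.2 hδ1
  calc ∫ x, V x * φ x ^ 2 ∂μ
      ≤ (∑ j, ∫ x, W j x * (χ j x * φ x) ^ 2 ∂μ) + B * ∫ x in K, φ x ^ 2 ∂μ :=
        integral_potential_le_of_localization hs ht hK hV hW hle hφ fun j => hχφ j φ hφ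
    _ ≤ (1 - δ) * (∑ j, ∫ x, ‖gradient (fun y => χ j y * φ y) x‖ ^ 2 ∂μ) +
          B * ∫ x in K, φ x ^ 2 ∂μ := by
        rw [Finset.mul_sum]
        gcongr with j
        exact hform j _ (hχφ j φ hφ)
    _ ≤ (1 - δ) * ((1 + δ / 2) * (∫ x, ‖gradient φ x‖ ^ 2 ∂μ) +
          (1 + (δ / 2)⁻¹) * (Fintype.card J * L) * ∫ x in K, φ x ^ 2 ∂μ) +
          B * ∫ x in K, φ x ^ 2 ∂μ := by
        gcongr
        exact sum_integral_normSq_gradient_mul_le hK hχ hsum hgrad hφ (fun j => hχφ j φ hφ)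
          (half_pos hδ0)
    _ ≤ (1 - δ / 2) * (∫ x, ‖gradient φ x‖ ^ 2 ∂μ) +
          ((1 - δ) * ((1 + (δ / 2)⁻¹) * (Fintype.card J * L)) + B) * ∫ x in K, φ x ^ 2 ∂μ := by
        nlinarith [mul_nonneg (sq_nonneg δ) hD0]

end Localization

section Asymptotics

variable {N : ℕ}

lemma polePotential_zero_smul (f : Sph N → ℝ) {r : ℝ} (hr : 0 < r) (x : RN N) :
    polePotential f 0 (r • x) = (r ^ 2)⁻¹ * polePotential f 0 x := by
  simp only [polePotential, sub_zero, angular_smul_right f hr, norm_smul, Real.norm_of_nonneg hr.le,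
    mul_pow]
  field_simp

lemma polePotential_eq_zero_sub (f : Sph N → ℝ) (a x : RN N) :
    polePotential f a x = polePotential f 0 (x - a) := by
  rw [polePotential, polePotential, sub_zero]

lemma polePotential_sum {ι : Type*} [Fintype ι] (f : ι → Sph N → ℝ) (a x : RN N) :
    polePotential (fun θ => ∑ i, f i θ) a x = ∑ i, polePotential (f i) a x := by
  simp only [polePotential, ← Finset.sum_div]
  congr 1
  rcases eq_or_ne (x - a) 0 with hx | hx
  · simp [angular, hx]
  · simp only [angular_of_ne_zero _ hx]

lemma eventually_abs_polePotential_sub_le {f : Sph N → ℝ} (hf : Continuous f) (a : RN N)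
    {ε : ℝ} (hε : 0 < ε) :
    ∀ᶠ x in Bornology.cobounded (RN N),
      |polePotential f a x - polePotential f 0 x| ≤ ε * (‖x‖ ^ 2)⁻¹ := by
  have hcont : ∀ y ∈ sphere (0 : RN N) 1, ContinuousAt (polePotential f 0) y := fun y hy =>
    (continuousOn_polePotential hf 0).continuousAt
      (isOpen_compl_singleton.mem_nhds (ne_zero_of_mem_unit_sphere ⟨y, hy⟩))
  have hunif := (isCompact_sphere (0 : RN N) 1).uniformContinuousAt_of_continuousAt
    (polePotential f 0) hcont (dist_mem_uniformity hε)
  obtain ⟨d, hd0, hd⟩ := mem_uniformity_dist.1 hunif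
  filter_upwards [tendsto_norm_cobounded_atTop.eventually_gt_atTop (max 0 (‖a‖ / d))] with x hx
  obtain ⟨hx0, hxa⟩ := max_lt_iff.1 hx
  have polePotential_eq : ∀ b, polePotential f b x =
      (‖x‖ ^ 2)⁻¹ * polePotential f 0 (‖x‖⁻¹ • (x - b)) := fun b => by
    rw [polePotential_zero_smul f (inv_pos.2 hx0), polePotential_eq_zero_sub f b, ← mul_assoc,
      inv_pow, inv_inv, inv_mul_cancel₀ (by positivity), one_mul]
  have hsphere : ‖x‖⁻¹ • (x - 0) ∈ sphere (0 : RN N) 1 := by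
    simp [norm_smul, hx0.ne']
  have hdist : dist (‖x‖⁻¹ • (x - 0)) (‖x‖⁻¹ • (x - a)) < d := by
    rw [dist_eq_norm, ← smul_sub, norm_smul, sub_sub_sub_cancel_left, sub_zero, norm_inv, norm_norm,
      inv_mul_lt_iff₀ hx0]
    exact (div_lt_iff₀ hd0).1 hxa
  have hclose : |polePotential f 0 (‖x‖⁻¹ • (x - 0)) - polePotential f 0 (‖x‖⁻¹ • (x - a))| < ε :=
    hd hdist hsphere
  rw [polePotential_eq a, polePotential_eq 0, ← mul_sub, abs_mul, abs_of_nonneg (by positivity),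
    abs_sub_comm, mul_comm]
  gcongr

lemma exists_radius_abs_sum_polePotential_sub_le {ι : Type*} [Fintype ι] {f : ι → Sph N → ℝ}
    (hf : ∀ i, Continuous (f i)) (a : ι → RN N) {ε : ℝ} (hε : 0 < ε) :
    ∃ R : ℝ, ∀ x, R ≤ ‖x‖ → |∑ i, polePotential (f i) (a i) x -
      polePotential (fun θ => ∑ i, f i θ) 0 x| ≤ ε * (‖x‖ ^ 2)⁻¹ := by
  have hcard : 0 < (Fintype.card ι : ℝ) + 1 := by positivity
  have hterm := eventually_all.2 fun i =>
    eventually_abs_polePotential_sub_le (hf i) (a i) (div_pos hε hcard)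
  obtain ⟨R, -, hR⟩ := hasBasis_cobounded_norm.eventually_iff.1 hterm
  refine ⟨R, fun x hx => ?_⟩
  rw [polePotential_sum, ← Finset.sum_sub_distrib]
  calc |∑ i, (polePotential (f i) (a i) x - polePotential (f i) 0 x)|
      ≤ ∑ _i : ι, ε / (Fintype.card ι + 1) * (‖x‖ ^ 2)⁻¹ :=
        (Finset.abs_sum_le_sum_abs _ _).trans (Finset.sum_le_sum fun i _ => hR hx i)
    _ = Fintype.card ι / (Fintype.card ι + 1) * (ε * (‖x‖ ^ 2)⁻¹) := by
        rw [Finset.sum_const, Finset.card_univ, nsmul_eq_mul]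
        ring
    _ ≤ ε * (‖x‖ ^ 2)⁻¹ :=
        mul_le_of_le_one_left (by positivity) ((div_le_one hcard).2 (by linarith))

end Asymptotics

section PoleLocalization

lemma exists_pos_le_dist_of_injective {X ι : Type*} [MetricSpace X] [Finite ι] {a : ι → X}
    (ha : Function.Injective a) : ∃ r : ℝ, 0 < r ∧ ∀ i j, i ≠ j → 4 * r ≤ dist (a i) (a j) := by
  have hsmall : ∀ᶠ r in 𝓝[>] (0 : ℝ), ∀ i j, i ≠ j → 4 * r ≤ dist (a i) (a j) := by
    refine eventually_all.2 fun i => eventually_all.2 fun j => ?_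
    by_cases hij : i = j
    · exact .of_forall fun _ h => absurd hij h
    · have hd : 0 < dist (a i) (a j) := dist_pos.2 (ha.ne hij)
      filter_upwards [Ioo_mem_nhdsGT (div_pos hd four_pos)] with r hr _
      linarith [hr.2]
  obtain ⟨r, hr, hr0⟩ := (hsmall.and self_mem_nhdsWithin).exists
  exact ⟨r, hr0, hr⟩

variable {E ι : Type*} [NormedAddCommGroup E] [InnerProductSpace ℝ E] {a : ι → E} {r R : ℝ}
  {χ : Option ι → E → ℝ}

/-- A family of cutoff functions with pairwise disjoint supports localizing to the balls of radius
`r` around the points `a i` (index `some i`) and to a neighbourhood of infinity (index `none`). -/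
structure IsPoleLocalization (a : ι → E) (r R : ℝ) (χ : Option ι → E → ℝ) : Prop where
  contDiff : ∀ j, ContDiff ℝ ∞ (χ j)
  mem_Icc : ∀ j x, χ j x ∈ Set.Icc 0 1
  mul_eq_zero : ∀ j l, j ≠ l → ∀ x, χ j x * χ l x = 0
  some_eq_one : ∀ i x, dist x (a i) ≤ r → χ (some i) x = 1
  some_eq_zero : ∀ i x, 2 * R ≤ ‖x‖ → χ (some i) x = 0
  none_eq_zero : ∀ x, ‖x‖ ≤ R → χ none x = 0
  none_eq_one : ∀ x, 2 * R ≤ ‖x‖ → χ none x = 1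

/-- The pole of the `j`-th localized operator; at infinity (`none`) all poles merge at `0`. -/
def localPole (a : ι → E) (j : Option ι) : E := j.elim 0 a

lemma exists_isPoleLocalization [FiniteDimensional ℝ E] [Finite ι] (ha : Function.Injective a)
    (R₀ : ℝ) : ∃ r R : ℝ, 0 < r ∧ 0 < R ∧ R₀ ≤ R ∧ ∃ χ, IsPoleLocalization a r R χ := by
  obtain ⟨r, hr0, hsep⟩ := exists_pos_le_dist_of_injective ha
  obtain ⟨R, hR0, hRR₀, hRa⟩ : ∃ R : ℝ, 0 < R ∧ R₀ ≤ R ∧ ∀ i, ‖a i‖ + 2 * r ≤ R :=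
    ((eventually_gt_atTop _).and ((eventually_ge_atTop _).and
      (eventually_all.2 fun i => eventually_ge_atTop _))).exists
  let bump : ∀ i, ContDiffBump (a i) := fun i => ⟨r, 2 * r, hr0, by linarith⟩
  let bump₀ : ContDiffBump (0 : E) := ⟨R, 2 * R, hR0, by linarith⟩
  have dist_of_ne_zero : ∀ {i x}, bump i x ≠ 0 → dist x (a i) < 2 * r := fun {i x} h =>
    not_le.1 fun hx => h ((bump i).zero_of_le_dist hx)
  have norm_of_ne_zero : ∀ {i x}, bump i x ≠ 0 → ‖x‖ < R := fun {i x} h => by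
    linarith [dist_of_ne_zero h, norm_le_norm_add_norm_sub' x (a i), dist_eq_norm x (a i), hRa i]
  have bump₀_eq_one : ∀ {x}, ‖x‖ ≤ R → bump₀ x = 1 := fun hx =>
    bump₀.one_of_mem_closedBall (by simpa using hx)
  have bump_mul_eq_zero : ∀ i l, i ≠ l → ∀ x, bump i x * bump l x = 0 := fun i l hil x => by
    by_contra h
    linarith [hsep i l hil, dist_triangle_left (a i) (a l) x,
      dist_of_ne_zero (left_ne_zero_of_mul h), dist_of_ne_zero (right_ne_zero_of_mul h)]
  have bump_mul_one_sub_eq_zero : ∀ i x, bump i x * (1 - bump₀ x) = 0 := fun i x => by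
    by_contra h
    exact right_ne_zero_of_mul h
      (sub_eq_zero.2 (bump₀_eq_one (norm_of_ne_zero (left_ne_zero_of_mul h)).le).symm)
  refine ⟨r, R, hr0, hR0, hRR₀, fun j => j.elim (fun x => 1 - bump₀ x) (fun i => bump i), ?_⟩
  constructor
  · rintro (_ | i)
    exacts [contDiff_const.sub bump₀.contDiff, (bump i).contDiff]
  · rintro (_ | i) x
    exacts [⟨sub_nonneg.2 bump₀.le_one, sub_le_self _ bump₀.nonneg⟩,
      ⟨(bump i).nonneg, (bump i).le_one⟩]
  · rintro (_ | i) (_ | l) hne x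
    exacts [absurd rfl hne, (mul_comm _ _).trans (bump_mul_one_sub_eq_zero l x),
      bump_mul_one_sub_eq_zero i x, bump_mul_eq_zero i l (by simpa using hne) x]
  · exact fun i x hx => (bump i).one_of_mem_closedBall hx
  · exact fun i x hx => by_contra fun h => by linarith [norm_of_ne_zero h]
  · exact fun x hx => sub_eq_zero.2 (bump₀_eq_one hx).symm
  · exact fun x hx => sub_eq_self.2 (bump₀.zero_of_le_dist (by simpa using hx))

namespace IsPoleLocalization

lemma sq_le_one (hχ : IsPoleLocalization a r R χ) (j : Option ι) (x : E) : χ j x ^ 2 ≤ 1 :=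
  pow_le_one₀ (hχ.mem_Icc j x).1 (hχ.mem_Icc j x).2

lemma sum_sq_le_one [Fintype ι] (hχ : IsPoleLocalization a r R χ) (x : E) :
    ∑ j, χ j x ^ 2 ≤ 1 := by
  by_cases h : ∃ j, χ j x ≠ 0
  · obtain ⟨j, hj⟩ := h
    have hothers : ∀ l, l ≠ j → χ l x ^ 2 = 0 := fun l hl => by
      rw [(mul_eq_zero_iff_right hj).1 (hχ.mul_eq_zero l j hl x), zero_pow two_ne_zero]
    rw [Fintype.sum_eq_single j hothers]
    exact hχ.sq_le_one j x
  · push Not at h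
    simp [h]

lemma exists_normSq_gradient_le [Finite ι] [FiniteDimensional ℝ E]
    (hχ : IsPoleLocalization a r R χ) :
    ∃ L : ℝ, ∀ j x, ‖gradient (χ j) x‖ ^ 2 ≤ L * (closedBall 0 (2 * R)).indicator 1 x := by
  have := Fintype.ofFinite ι
  have eventually_norm_ge : ∀ x ∉ closedBall (0 : E) (2 * R), ∀ᶠ y in 𝓝 x, 2 * R ≤ ‖y‖ :=
    fun x hx => (continuous_norm.tendsto x).eventually_const_le (by simpa using hx)
  have gradient_eq_zero : ∀ j, ∀ x ∉ closedBall (0 : E) (2 * R), gradient (χ j) x = 0 := by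
    rintro (_ | i) x hx
    · have hone : χ none =ᶠ[𝓝 x] fun _ => 1 := (eventually_norm_ge x hx).mono hχ.none_eq_one
      rw [hone.gradient_eq, gradient_fun_const]
    · have hzero : χ (some i) =ᶠ[𝓝 x] fun _ => 0 :=
        (eventually_norm_ge x hx).mono (hχ.some_eq_zero i)
      rw [hzero.gradient_eq, gradient_fun_const]
  choose L hL using fun j => exists_normSq_gradient_le_indicator ((hχ.contDiff j).of_le (by simp))
    (isCompact_closedBall 0 (2 * R)) (gradient_eq_zero j)
  refine ⟨∑ j, |L j|, fun j x => (hL j x).trans ?_⟩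
  gcongr
  · exact Set.indicator_nonneg (fun _ _ => zero_le_one) x
  · exact (le_abs_self _).trans
      (Finset.single_le_sum (fun l _ => abs_nonneg (L l)) (Finset.mem_univ j))

lemma isTestFunction_mul (hχ : IsPoleLocalization a r R χ) (hR : 0 < R) {φ : E → ℝ}
    (hφ : IsTestFunction (Set.range a) φ) (j : Option ι) :
    IsTestFunction {localPole a j} (fun x => χ j x * φ x) := by
  rcases j with _ | i
  · refine ⟨(hφ.mul_left (hχ.contDiff none)).contDiff,
      (hφ.mul_left (hχ.contDiff none)).hasCompactSupport, ?_⟩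
    rw [localPole, Option.elim_none, Set.disjoint_singleton_right, notMem_tsupport_iff_eventuallyEq]
    filter_upwards [ball_mem_nhds (0 : E) hR] with x hx
    simp [hχ.none_eq_zero x (mem_ball_zero_iff.1 hx).le]
  · exact (hφ.mul_left (hχ.contDiff (some i))).mono
      (Set.singleton_subset_iff.2 (Set.mem_range_self i))

end IsPoleLocalization

end PoleLocalization

section MultiPole

variable {N : ℕ}

lemma abs_polePotential_mul_le {f : Sph N → ℝ} {M : ℝ} (hM : ∀ θ, |f θ| ≤ M) (hM0 : 0 ≤ M)
    {a x : RN N} {r : ℝ} (hr : 0 < r) {c : ℝ} (hc1 : c ≤ 1) (hc : dist x a ≤ r → c = 0) :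
    |polePotential f a x| * c ≤ M * (r ^ 2)⁻¹ := by
  rcases le_total (dist x a) r with hx | hx
  · rw [hc hx, mul_zero]
    positivity
  · rw [dist_eq_norm] at hx
    calc |polePotential f a x| * c ≤ |polePotential f a x| :=
          mul_le_of_le_one_right (abs_nonneg _) hc1
      _ ≤ M * (‖x - a‖ ^ 2)⁻¹ := abs_polePotential_le hM hM0 a x
      _ ≤ M * (r ^ 2)⁻¹ := by gcongr

variable {ι : Type*} [Fintype ι] {f : ι → Sph N → ℝ} {a : ι → RN N} {r R δ : ℝ}
  {χ : Option ι → RN N → ℝ}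

/-- The angular profile of the `j`-th localized operator; at infinity (`none`) it is the sum of all
profiles. -/
def localProfile (f : ι → Sph N → ℝ) (j : Option ι) : Sph N → ℝ :=
  j.elim (fun θ => ∑ i, f i θ) f

/-- The potential of the `j`-th localized operator, enlarged by a multiple of the Hardy weight. -/
noncomputable def localPotential (f : ι → Sph N → ℝ) (a : ι → RN N) (δ : ℝ) (j : Option ι)
    (x : RN N) : ℝ :=
  polePotential (localProfile f j) (localPole a j) x + δ * (‖x - localPole a j‖ ^ 2)⁻¹

lemma continuous_localProfile (hf : ∀ i, Continuous (f i)) (j : Option ι) :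
    Continuous (localProfile f j) := by
  rcases j with _ | i
  exacts [continuous_finsetSum _ fun i _ => hf i, hf i]

lemma continuousOn_localPotential (hf : ∀ i, Continuous (f i)) (a : ι → RN N) (δ : ℝ)
    (j : Option ι) : ContinuousOn (localPotential f a δ j) {localPole a j}ᶜ :=
  (continuousOn_polePotential (continuous_localProfile hf j) _).add
    (continuousOn_const.mul (continuousOn_inv_normSq_sub _))

lemma continuousOn_sum_polePotential (hf : ∀ i, Continuous (f i)) (a : ι → RN N) :
    ContinuousOn (fun x => ∑ i, polePotential (f i) (a i) x) (Set.range a)ᶜ :=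
  continuousOn_finsetSum _ fun i _ => (continuousOn_polePotential (hf i) (a i)).mono
    (Set.compl_subset_compl.2 (Set.singleton_subset_iff.2 (Set.mem_range_self i)))

lemma polePotential_mul_le_localPotential_mul (hδ : 0 ≤ δ) (j : Option ι) (x : RN N) {c : ℝ}
    (hc : 0 ≤ c) :
    polePotential (localProfile f j) (localPole a j) x * c ≤ localPotential f a δ j x * c :=
  mul_le_mul_of_nonneg_right (le_add_of_nonneg_right (by positivity)) hc

namespace IsPoleLocalization

lemma polePotential_le_localPotential_mul_sq_add (hχ : IsPoleLocalization a r R χ) (hr : 0 < r)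
    (hδ : 0 ≤ δ) {i : ι} {M : ℝ} (hM : ∀ θ, |f i θ| ≤ M) (hM0 : 0 ≤ M) (x : RN N) :
    polePotential (f i) (a i) x ≤
      localPotential f a δ (some i) x * χ (some i) x ^ 2 + M * (r ^ 2)⁻¹ := by
  have hfar := abs_polePotential_mul_le (x := x) (a := a i) hM hM0 hr
    (sub_le_self _ (sq_nonneg (χ (some i) x)))
    fun hx => by rw [hχ.some_eq_one i x hx, one_pow, sub_self]
  have hnear : polePotential (f i) (a i) x * χ (some i) x ^ 2 ≤
      localPotential f a δ (some i) x * χ (some i) x ^ 2 :=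
    polePotential_mul_le_localPotential_mul hδ (some i) x (sq_nonneg _)
  have hcut := mul_le_mul_of_nonneg_right (le_abs_self (polePotential (f i) (a i) x))
    (sub_nonneg.2 (hχ.sq_le_one (some i) x))
  linarith

lemma localPotential_none_mul_sq_add_nonneg (hχ : IsPoleLocalization a r R χ) (hR : 0 < R)
    (hδ : 0 ≤ δ) {M : ℝ} (hM : ∀ θ, |localProfile f none θ| ≤ M) (hM0 : 0 ≤ M) (x : RN N) :
    0 ≤ localPotential f a δ none x * χ none x ^ 2 + M * (R ^ 2)⁻¹ := by
  have hbdd := abs_polePotential_mul_le (x := x) (a := 0) hM hM0 hR (hχ.sq_le_one none x)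
    fun hx => by rw [hχ.none_eq_zero x (by simpa using hx), zero_pow two_ne_zero]
  have hlocal : polePotential (localProfile f none) 0 x * χ none x ^ 2 ≤
      localPotential f a δ none x * χ none x ^ 2 :=
    polePotential_mul_le_localPotential_mul hδ none x (sq_nonneg _)
  have hcut := mul_le_mul_of_nonneg_right
    (neg_abs_le (polePotential (localProfile f none) 0 x)) (sq_nonneg (χ none x))
  linarith

lemma exists_sum_polePotential_le (hχ : IsPoleLocalization a r R χ)
    (hr : 0 < r) (hR : 0 < R) (hf : ∀ i, Continuous (f i)) (hδ : 0 ≤ δ)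
    (hinfty : ∀ x, R ≤ ‖x‖ → |∑ i, polePotential (f i) (a i) x -
      polePotential (fun θ => ∑ i, f i θ) 0 x| ≤ δ * (‖x‖ ^ 2)⁻¹) :
    ∃ B : ℝ, ∀ x, ∑ i, polePotential (f i) (a i) x ≤
      ∑ j, localPotential f a δ j x * χ j x ^ 2 + B * (closedBall 0 (2 * R)).indicator 1 x := by
  choose M hM0 hM using fun j => exists_abs_le_of_continuous (continuous_localProfile hf j)
  refine ⟨M none * (R ^ 2)⁻¹ + ∑ i, M (some i) * (r ^ 2)⁻¹, fun x => ?_⟩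
  rw [Fintype.sum_option]
  by_cases hx : x ∈ closedBall 0 (2 * R)
  · have hpoles := Finset.sum_le_sum fun i (_ : i ∈ Finset.univ) =>
      hχ.polePotential_le_localPotential_mul_sq_add hr hδ (hM (some i)) (hM0 _) x
    have hnone := hχ.localPotential_none_mul_sq_add_nonneg hR hδ (hM none) (hM0 _) x
    rw [Finset.sum_add_distrib] at hpoles
    rw [Set.indicator_of_mem hx, Pi.one_apply, mul_one]
    linarith
  · have hx' : 2 * R ≤ ‖x‖ := by
      rw [mem_closedBall_zero_iff, not_le] at hx
      exact hx.le
    have hmerge := (abs_le.1 (hinfty x (by linarith))).2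
    simp only [Set.indicator_of_notMem hx, hχ.none_eq_one x hx', hχ.some_eq_zero _ x hx',
      localPotential, localProfile, localPole, Option.elim_none, sub_zero,
      one_pow, mul_one, zero_pow two_ne_zero, mul_zero, Finset.sum_const_zero, add_zero]
    linarith

end IsPoleLocalization

variable [Fact (3 ≤ N)]

lemma exists_uniform_hardy_gap {J : Type*} [Finite J] {f : J → Sph N → ℝ} {p : J → RN N}
    (hf : ∀ j, Continuous (f j))
    (hμ : ∀ j, sphereFirstEigenvalue (f j) > -((((N : ℝ) - 2) / 2) ^ 2)) :
    ∃ δ : ℝ, 0 < δ ∧ δ ≤ 1 ∧ ∀ j φ, IsTestFunction {p j} φ →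
      ∫ x, (polePotential (f j) (p j) x + δ * (‖x - p j‖ ^ 2)⁻¹) * φ x ^ 2 ≤
        (1 - δ) * ∫ x, ‖gradient φ x‖ ^ 2 := by
  choose d hd0 hd using fun j => exists_hardy_gap (hf j) (hμ j) (p j)
  have hsmall : ∀ᶠ δ in 𝓝[>] (0 : ℝ), δ ≤ 1 ∧ ∀ j, δ ≤ d j :=
    (eventually_nhdsWithin_of_eventually_nhds (eventually_le_nhds one_pos)).and
      (eventually_all.2 fun j =>
        eventually_nhdsWithin_of_eventually_nhds (eventually_le_nhds (hd0 j)))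
  obtain ⟨δ, ⟨hδ1, hδd⟩, hδ0⟩ := (hsmall.and self_mem_nhdsWithin).exists
  refine ⟨δ, hδ0, hδ1, fun j φ hφ => ?_⟩
  have hsplit : ∫ x, (polePotential (f j) (p j) x + δ * (‖x - p j‖ ^ 2)⁻¹) * φ x ^ 2 =
      (∫ x, polePotential (f j) (p j) x * φ x ^ 2) + δ * ∫ x, (‖x - p j‖ ^ 2)⁻¹ * φ x ^ 2 := by
    simp only [add_mul, mul_assoc]
    rw [integral_add (hφ.integrable_mul_sq isClosed_singleton (continuousOn_polePotential (hf j) _))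
      ((hφ.integrable_mul_sq isClosed_singleton (continuousOn_inv_normSq_sub _)).const_mul δ),
      integral_const_mul]
  have hweight : δ * (∫ x, (‖x - p j‖ ^ 2)⁻¹ * φ x ^ 2) ≤
      d j * ∫ x, (‖x - p j‖ ^ 2)⁻¹ * φ x ^ 2 :=
    mul_le_mul_of_nonneg_right (hδd j) (integral_nonneg fun x => by positivity)
  have hgradient : (1 - d j) * (∫ x, ‖gradient φ x‖ ^ 2) ≤
      (1 - δ) * ∫ x, ‖gradient φ x‖ ^ 2 :=
    mul_le_mul_of_nonneg_right (by linarith [hδd j]) (integral_nonneg fun x => by positivity)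
  linarith [hd j φ hφ]

lemma exists_localized_form_bound (hf : ∀ i, Continuous (f i)) (ha : Function.Injective a)
    (hμ : ∀ i, sphereFirstEigenvalue (f i) > -((((N : ℝ) - 2) / 2) ^ 2))
    (hμsum : sphereFirstEigenvalue (fun θ => ∑ i, f i θ) > -((((N : ℝ) - 2) / 2) ^ 2)) :
    ∃ δ C R : ℝ, 0 < δ ∧ ∀ φ, IsTestFunction (Set.range a) φ →
      ∫ x, (∑ i, polePotential (f i) (a i) x) * φ x ^ 2 ≤
        (1 - δ) * (∫ x, ‖gradient φ x‖ ^ 2) + C * ∫ x in closedBall 0 R, φ x ^ 2 := by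
  have hμlocal : ∀ j, sphereFirstEigenvalue (localProfile f j) > -((((N : ℝ) - 2) / 2) ^ 2) := by
    rintro (_ | i)
    exacts [hμsum, hμ i]
  obtain ⟨δ, hδ0, hδ1, hgap⟩ := exists_uniform_hardy_gap (p := localPole a)
    (continuous_localProfile hf) hμlocal
  obtain ⟨R₀, hR₀⟩ := exists_radius_abs_sum_polePotential_sub_le hf a hδ0
  obtain ⟨r, R, hr0, hR0, hRR₀, χ, hχ⟩ := exists_isPoleLocalization ha R₀
  obtain ⟨L, hL⟩ := hχ.exists_normSq_gradient_le
  obtain ⟨B, hB⟩ := hχ.exists_sum_polePotential_le hr0 hR0 hf hδ0.le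
    fun x hx => hR₀ x (hRR₀.trans hx)
  obtain ⟨C, hC⟩ := exists_form_bound_of_localization (Set.finite_range a).isClosed
    (fun _ => isClosed_singleton) measurableSet_closedBall (continuousOn_sum_polePotential hf a)
    (continuousOn_localPotential hf a δ) hB
    (fun j => (hχ.contDiff j).differentiable (by simp)) hχ.sum_sq_le_one hL
    (fun j φ hφ => hχ.isTestFunction_mul hR0 hφ j) hδ0 hδ1 hgap
  exact ⟨δ / 2, C, 2 * R, half_pos hδ0, hC⟩

end MultiPole

section Sobolev

lemma two_lt_critExp (N : ℕ) [hN : Fact (3 ≤ N)] : 2 < critExp N := by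
  have h3 : (3 : ℝ) ≤ N := by exact_mod_cast hN.out
  rw [critExp, lt_div_iff₀ (by linarith)]
  linarith

lemma ofReal_critExp_ne_zero (N : ℕ) [Fact (3 ≤ N)] : ENNReal.ofReal (critExp N) ≠ 0 :=
  (ENNReal.ofReal_pos.2 (two_pos.trans (two_lt_critExp N))).ne'

lemma one_le_ofReal_critExp (N : ℕ) [Fact (3 ≤ N)] : 1 ≤ ENNReal.ofReal (critExp N) :=
  ENNReal.one_le_ofReal.2 (by linarith [two_lt_critExp N])

lemma eLpNorm_two_eq_sqrt {α F : Type*} [MeasurableSpace α] {μ : Measure α}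
    [NormedAddCommGroup F] {f : α → F} (hf : MemLp f 2 μ) :
    eLpNorm f 2 μ = ENNReal.ofReal (Real.sqrt (∫ x, ‖f x‖ ^ 2 ∂μ)) := by
  rw [hf.eLpNorm_eq_integral_rpow_norm two_ne_zero ENNReal.ofNat_ne_top, Real.sqrt_eq_rpow]
  simp

lemma exists_eLpNorm_critExp_le (N : ℕ) [hN : Fact (3 ≤ N)] :
    ∃ C : NNReal, ∀ φ : RN N → ℝ, ContDiff ℝ 1 φ → HasCompactSupport φ →
      eLpNorm φ (ENNReal.ofReal (critExp N)) ≤ C * eLpNorm (gradient φ) 2 := by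
  refine ⟨SNormLESNormFDerivOfEqConst ℝ (volume : Measure (RN N)) 2, fun φ hφ hφc => ?_⟩
  have h3 : (3 : ℝ) ≤ N := by exact_mod_cast hN.out
  have hfinrank : 2 < Module.finrank ℝ (RN N) := by
    rw [finrank_euclideanSpace_fin]
    exact hN.out
  have hexp : ((critExp N).toNNReal : ℝ)⁻¹ = (2 : ℝ)⁻¹ - (Module.finrank ℝ (RN N) : ℝ)⁻¹ := by
    have hN2 : (N : ℝ) - 2 ≠ 0 := by linarith
    rw [Real.coe_toNNReal _ (two_pos.trans (two_lt_critExp N)).le, finrank_euclideanSpace_fin,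
      critExp]
    field_simp
  refine (eLpNorm_le_eLpNorm_fderiv_of_eq volume hφ hφc one_le_two (two_pos.trans hfinrank)
    hexp).trans_eq ?_
  congr 1
  exact eLpNorm_congr_norm_ae (.of_forall fun x => (norm_gradient_eq φ x).symm)

lemma exists_setIntegral_sq_le_rpow_measureReal (N : ℕ) [Fact (3 ≤ N)] :
    ∃ C e : ℝ, 0 < e ∧ ∀ A : Set (RN N), volume A ≠ ⊤ →
      ∀ φ : RN N → ℝ, ContDiff ℝ 1 φ → HasCompactSupport φ →
      ∫ x in A, φ x ^ 2 ≤ C * volume.real A ^ e * ∫ x, ‖gradient φ x‖ ^ 2 := by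
  obtain ⟨C, hC⟩ := exists_eLpNorm_critExp_le N
  have hp := two_lt_critExp N
  set e : ℝ := 1 / 2 - 1 / critExp N with he
  have he0 : 0 < e := sub_pos.2 (one_div_lt_one_div_of_lt two_pos hp)
  refine ⟨(C : ℝ) ^ 2, e * 2, by positivity, fun A hA φ hφ hφc => ?_⟩
  have hφ2 : MemLp φ 2 (volume.restrict A) :=
    (hφ.continuous.memLp_of_hasCompactSupport hφc).restrict A
  have hexp : (2 : ENNReal) ≤ ENNReal.ofReal (critExp N) := by
    simpa only [ENNReal.ofReal_ofNat] using ENNReal.ofReal_le_ofReal hp.le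
  have hsobolev : eLpNorm φ (ENNReal.ofReal (critExp N)) (volume.restrict A) ≤
      C * eLpNorm (gradient φ) 2 :=
    (eLpNorm_mono_measure _ Measure.restrict_le_self).trans (hC φ hφ hφc)
  have hholder := (eLpNorm_le_eLpNorm_mul_rpow_measure_univ hexp hφ2.1).trans
    (mul_le_mul_left hsobolev _)
  rw [eLpNorm_two_eq_sqrt hφ2, eLpNorm_two_eq_sqrt (memLp_gradient hφ hφc 2),
    Measure.restrict_apply_univ, ENNReal.toReal_ofReal (by linarith), ENNReal.toReal_ofNat, ← he,
    ← ENNReal.ofReal_toReal hA, ENNReal.ofReal_rpow_of_nonneg ENNReal.toReal_nonneg he0.le,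
    ← ENNReal.ofReal_coe_nnreal, ← ENNReal.ofReal_mul (by positivity),
    ← ENNReal.ofReal_mul (by positivity), ENNReal.ofReal_le_ofReal_iff (by positivity)] at hholder
  have hsq := pow_le_pow_left₀ (Real.sqrt_nonneg _) hholder 2
  simp only [mul_pow, Real.sq_sqrt (integral_nonneg fun _ => sq_nonneg _), Real.norm_eq_abs,
    sq_abs] at hsq
  refine hsq.trans_eq ?_
  rw [Measure.real, Real.rpow_mul ENNReal.toReal_nonneg, Real.rpow_two]
  ring

lemma exists_setIntegral_sq_le_of_measure_le (N : ℕ) [Fact (3 ≤ N)] {ε : ℝ} (hε : 0 < ε) :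
    ∃ t : ℝ, 0 < t ∧ ∀ A : Set (RN N), volume A ≤ ENNReal.ofReal t →
      ∀ φ : RN N → ℝ, ContDiff ℝ 1 φ → HasCompactSupport φ →
      ∫ x in A, φ x ^ 2 ≤ ε * ∫ x, ‖gradient φ x‖ ^ 2 := by
  obtain ⟨C, e, he, hC⟩ := exists_setIntegral_sq_le_rpow_measureReal N
  have hlim : Tendsto (fun t : ℝ => |C| * t ^ e) (𝓝 0) (𝓝 0) := by
    simpa only [Real.zero_rpow he.ne', mul_zero] using
      ((Real.continuous_rpow_const he.le).tendsto 0).const_mul |C|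
  obtain ⟨t, htε, ht⟩ := (((hlim.mono_left nhdsWithin_le_nhds).eventually_lt_const hε).and
    (self_mem_nhdsWithin (s := Set.Ioi 0))).exists
  refine ⟨t, ht, fun A hA φ hφ hφc =>
    (hC A (hA.trans_lt ENNReal.ofReal_lt_top).ne φ hφ hφc).trans ?_⟩
  gcongr
  calc C * volume.real A ^ e ≤ |C| * t ^ e := by
        gcongr
        exacts [le_abs_self C, ENNReal.toReal_le_of_le_ofReal (le_of_lt ht) hA]
    _ ≤ ε := htε.le

end Sobolev

section PointRemoval

variable {E : Type*} [NormedAddCommGroup E] [InnerProductSpace ℝ E] {L t : ℝ} {a : E}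
  {s : Set E} {φ z : E → ℝ}

/-- `z` is a cutoff function around the point `a` at scale `t`: it equals `1` near `a`, vanishes
outside the closed ball of radius `t`, and has slope at most `L / t`. -/
structure IsPointCutoff [CompleteSpace E] (L : ℝ) (a : E) (t : ℝ) (z : E → ℝ) : Prop where
  contDiff : ContDiff ℝ ∞ z
  abs_le_one : ∀ x, |z x| ≤ 1
  eventuallyEq_one : z =ᶠ[𝓝 a] 1
  tsupport_subset : tsupport z ⊆ closedBall a t
  norm_gradient_le : ∀ x, ‖gradient z x‖ ≤ L / t

lemma exists_isPointCutoff (E : Type*) [NormedAddCommGroup E] [InnerProductSpace ℝ E]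
    [FiniteDimensional ℝ E] :
    ∃ L, ∀ (a : E) (t : ℝ), 0 < t → ∃ z, IsPointCutoff L a t z := by
  let ζ : ContDiffBump (0 : E) := ⟨1 / 2, 1, by norm_num, by norm_num⟩
  obtain ⟨L, hL⟩ := ContDiff.lipschitzWith_of_hasCompactSupport ζ.hasCompactSupport
    (ζ.contDiff (n := 1)) one_ne_zero
  refine ⟨L, fun a t ht => ?_⟩
  let σ : E → E := fun x => t⁻¹ • (x - a)
  have hσ : ContDiff ℝ ∞ σ := (contDiff_id.sub contDiff_const).const_smul t⁻¹
  have hσa : σ a = 0 := by simp only [σ, sub_self, smul_zero]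
  have hσdist (x y) : dist (σ x) (σ y) = t⁻¹ * dist x y := by
    simp only [σ, dist_smul₀, dist_sub_right, norm_inv, Real.norm_of_nonneg ht.le]
  refine ⟨fun x => ζ (σ x), ζ.contDiff.comp hσ, fun x => ?_, ?_, ?_, fun x => ?_⟩
  · rw [abs_of_nonneg ζ.nonneg]
    exact ζ.le_one
  · exact ζ.eventuallyEq_one.comp_tendsto (hσa ▸ hσ.continuous.tendsto a)
  · refine closure_minimal (fun x hx => ?_) isClosed_closedBall
    have hσx : σ x ∈ ball 0 1 := ζ.support_eq.subset hx
    rw [← hσa, mem_ball, hσdist, inv_mul_lt_one₀ ht] at hσx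
    exact hσx.le
  · rw [norm_gradient_eq, div_eq_mul_inv]
    have hσLip : LipschitzWith ⟨t⁻¹, by positivity⟩ σ :=
      .of_dist_le_mul fun x y => (hσdist x y).le
    exact norm_fderiv_le_of_lipschitz ℝ (hL.comp hσLip)

lemma IsPointCutoff.norm_gradient_mul_le [CompleteSpace E] {B B' : ℝ}
    (hz : IsPointCutoff L a t z) (ht : 0 < t) (ht1 : t ≤ 1) (hφ : Differentiable ℝ φ)
    (hB : ∀ x, ‖φ x‖ ≤ B) (hB' : ∀ x, ‖gradient φ x‖ ≤ B') (x : E) :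
    ‖gradient (fun x => z x * φ x) x‖ ≤ (B' + B * L) / t := by
  have hB0 : 0 ≤ B := (norm_nonneg _).trans (hB 0)
  have hB0' : 0 ≤ B' := (norm_nonneg _).trans (hB' 0)
  calc ‖gradient (fun x => z x * φ x) x‖
      = ‖z x • gradient φ x + φ x • gradient z x‖ := by
        rw [gradient_mul (hz.contDiff.differentiable (by simp) x) (hφ x)]
    _ ≤ 1 * B' + B * (L / t) := by
        refine (norm_add_le _ _).trans ?_
        rw [norm_smul, norm_smul]
        gcongr
        exacts [hz.abs_le_one x, hB' x, hB x, hz.norm_gradient_le x]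
    _ ≤ B' / t + B * (L / t) := by
        gcongr
        rw [one_mul]
        exact le_div_self hB0' ht ht1
    _ = (B' + B * L) / t := by ring

variable [FiniteDimensional ℝ E] [MeasurableSpace E] [BorelSpace E] {μ : Measure E}
  [μ.IsAddHaarMeasure]

lemma IsTestFunction.exists_eLpNorm_gradient_cutoff_mul_le (hφ : IsTestFunction s φ)
    (hE : 3 ≤ Module.finrank ℝ E) (L : ℝ) :
    ∃ C, ∀ (a : E) (t : ℝ) (z : E → ℝ), 0 < t → t ≤ 1 → IsPointCutoff L a t z →
      eLpNorm (gradient fun x => z x * φ x) 2 μ ≤ ENNReal.ofReal (Real.sqrt (C * t)) := by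
  obtain ⟨B, hB⟩ := hφ.hasCompactSupport.exists_bound_of_continuous hφ.continuous
  obtain ⟨B', hB'⟩ := (hφ.hasCompactSupport.mono'
    (support_gradient_subset φ)).exists_bound_of_continuous (continuous_gradient hφ.contDiff_one)
  set V := μ.real (ball 0 1)
  refine ⟨(B' + B * L) ^ 2 * V, fun a t z ht ht1 hz => ?_⟩
  have hzφ := hφ.mul_left hz.contDiff
  have hbound := hz.norm_gradient_mul_le ht ht1 hφ.differentiable hB hB'
  have hzero : ∀ x ∉ closedBall a t, ‖gradient (fun x => z x * φ x) x‖ ^ 2 = 0 := fun x hx => by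
    rw [Function.notMem_support.1 fun hx' => hx (hz.tsupport_subset (tsupport_mul_subset_left
      (support_gradient_subset _ hx'))), norm_zero, zero_pow two_ne_zero]
  rw [eLpNorm_two_eq_sqrt (memLp_gradient hzφ.contDiff_one hzφ.hasCompactSupport 2)]
  gcongr
  calc ∫ x, ‖gradient (fun x => z x * φ x) x‖ ^ 2 ∂μ
      = ∫ x in closedBall a t, ‖gradient (fun x => z x * φ x) x‖ ^ 2 ∂μ :=
        (setIntegral_eq_integral_of_forall_compl_eq_zero hzero).symm
    _ ≤ ((B' + B * L) / t) ^ 2 * μ.real (closedBall a t) := by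
        refine (Real.le_norm_self _).trans (norm_setIntegral_le_of_norm_le_const
          measure_closedBall_lt_top fun x _ => ?_)
        rw [norm_pow, norm_norm]
        gcongr
        exact hbound x
    _ = ((B' + B * L) / t) ^ 2 * (t ^ Module.finrank ℝ E * V) := by
        rw [Measure.real, Measure.addHaar_closedBall _ _ ht.le, ENNReal.toReal_mul,
          ENNReal.toReal_ofReal (by positivity), ← Measure.real]
    _ ≤ ((B' + B * L) / t) ^ 2 * (t ^ 3 * V) := by
        gcongr ?_ * (?_ * V)
        exact pow_le_pow_of_le_one ht.le ht1 hE
    _ = (B' + B * L) ^ 2 * V * t := by field_simp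

lemma IsTestFunction.exists_insert (hφ : IsTestFunction s φ) (hE : 3 ≤ Module.finrank ℝ E) (a : E)
    {ε : ENNReal} (hε : ε ≠ 0) :
    ∃ ψ, IsTestFunction (insert a s) ψ ∧ eLpNorm (gradient ψ - gradient φ) 2 μ ≤ ε := by
  obtain ⟨L, hL⟩ := exists_isPointCutoff E
  obtain ⟨C, hC⟩ := hφ.exists_eLpNorm_gradient_cutoff_mul_le (μ := μ) hE L
  have hlim : Tendsto (fun t => ENNReal.ofReal (Real.sqrt (C * t))) (𝓝[>] 0) (𝓝 0) := by
    have hcont : Continuous fun t => ENNReal.ofReal (Real.sqrt (C * t)) :=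
      ENNReal.continuous_ofReal.comp (by fun_prop)
    simpa using (hcont.tendsto 0).mono_left nhdsWithin_le_nhds
  obtain ⟨t, htε, ht0, ht1⟩ := ((hlim.eventually_le_const (pos_iff_ne_zero.2 hε)).and
    (Ioo_mem_nhdsGT one_pos)).exists
  obtain ⟨z, hz⟩ := hL a t ht0
  have hψ : IsTestFunction s (fun x => (1 - z x) * φ x) :=
    hφ.mul_left (contDiff_const.sub hz.contDiff)
  have hψφ : φ - (fun x => (1 - z x) * φ x) = fun x => z x * φ x := by
    ext x
    simp only [Pi.sub_apply]
    ring
  refine ⟨_, ⟨hψ.contDiff, hψ.hasCompactSupport, ?_⟩, ?_⟩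
  · refine Set.disjoint_insert_right.2 ⟨notMem_tsupport_iff_eventuallyEq.2 ?_, hψ.disjoint⟩
    filter_upwards [hz.eventuallyEq_one] with x hx
    simp only [hx, Pi.one_apply, sub_self, zero_mul, Pi.zero_apply]
  · rw [eLpNorm_sub_comm, ← gradient_sub hφ.differentiable hψ.differentiable, hψφ]
    exact (hC a t z ht0 ht1.le hz).trans htε

lemma IsTestFunction.exists_of_finite (hφ : IsTestFunction ∅ φ) (hs : s.Finite)
    (hE : 3 ≤ Module.finrank ℝ E) {ε : ENNReal} (hε : ε ≠ 0) :
    ∃ ψ, IsTestFunction s ψ ∧ eLpNorm (gradient ψ - gradient φ) 2 μ ≤ ε := by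
  induction s, hs using Set.Finite.induction_on generalizing ε with
  | empty => exact ⟨φ, hφ, by simp⟩
  | @insert a s _ _ ih =>
    obtain ⟨χ, hχ, hχφ⟩ := ih (ENNReal.half_pos hε).ne'
    obtain ⟨ψ, hψ, hψχ⟩ := hχ.exists_insert (μ := μ) hE a (ENNReal.half_pos hε).ne'
    have hm {f : E → ℝ} {s : Set E} (hf : IsTestFunction s f) :
        AEStronglyMeasurable (gradient f) μ :=
      (continuous_gradient hf.contDiff_one).aestronglyMeasurable
    refine ⟨ψ, hψ, ?_⟩
    calc eLpNorm (gradient ψ - gradient φ) 2 μ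
        ≤ eLpNorm (gradient ψ - gradient χ) 2 μ + eLpNorm (gradient χ - gradient φ) 2 μ :=
          eLpNorm_sub_le_add (hm hψ) (hm hχ) (hm hφ) one_le_two
      _ ≤ ε / 2 + ε / 2 := add_le_add hψχ hχφ
      _ = ε := ENNReal.add_halves ε

end PointRemoval

section Density

lemma tendsto_eLpNorm_sub_of_tendsto_eLpNorm_sub {α F : Type*} [MeasurableSpace α] {μ : Measure α}
    [NormedAddCommGroup F] {p : ENNReal} {f g : ℕ → α → F} {w : α → F}
    (hf : ∀ n, AEStronglyMeasurable (f n) μ) (hg : ∀ n, AEStronglyMeasurable (g n) μ)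
    (hw : AEStronglyMeasurable w μ) (hp : 1 ≤ p)
    (hfg : Tendsto (fun n => eLpNorm (f n - g n) p μ) atTop (𝓝 0))
    (hgw : Tendsto (fun n => eLpNorm (g n - w) p μ) atTop (𝓝 0)) :
    Tendsto (fun n => eLpNorm (f n - w) p μ) atTop (𝓝 0) :=
  tendsto_of_tendsto_of_tendsto_of_le_of_le tendsto_const_nhds
    (by simpa only [add_zero] using hfg.add hgw) (fun _ => zero_le)
    fun n => eLpNorm_sub_le_add (hf n) (hg n) hw hp

variable {N : ℕ} [hN : Fact (3 ≤ N)] {s : Set (RN N)} {u : RN N → ℝ} {G : RN N → RN N}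

lemma HasD12Grad.exists_seq_isTestFunction (hs : s.Finite) (hu : HasD12Grad u G) :
    ∃ ψ : ℕ → RN N → ℝ, (∀ n, IsTestFunction s (ψ n)) ∧
      (∀ᵐ x, Tendsto (fun n => ψ n x) atTop (𝓝 (u x))) ∧
      Tendsto (fun n => eLpNorm (gradient (ψ n) - G) 2) atTop (𝓝 0) := by
  obtain ⟨huLp, hG, w, hw, hwu, hwG⟩ := hu
  obtain ⟨C, hC⟩ := exists_eLpNorm_critExp_le N
  have hE : 3 ≤ Module.finrank ℝ (RN N) := finrank_euclideanSpace_fin (𝕜 := ℝ) ▸ hN.out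
  have hw' (n) : IsTestFunction ∅ (w n) := .of_contDiff_of_hasCompactSupport (hw n).1 (hw n).2
  choose ψ hψ hψw using fun n : ℕ => (hw' n).exists_of_finite (μ := volume) hs hE
    (ε := ENNReal.ofReal (1 / ((n : ℝ) + 1))) (by positivity)
  have hgrad : Tendsto (fun n => eLpNorm (gradient (ψ n) - gradient (w n)) 2) atTop (𝓝 0) :=
    tendsto_of_tendsto_of_tendsto_of_le_of_le tendsto_const_nhds
      (by simpa using ENNReal.tendsto_ofReal tendsto_one_div_add_atTop_nhds_zero_nat)
      (fun _ => zero_le) hψw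
  have hsobolev (n) : eLpNorm (ψ n - w n) (ENNReal.ofReal (critExp N)) ≤
      C * eLpNorm (gradient (ψ n) - gradient (w n)) 2 := by
    have hsub := ((hψ n).mono (Set.empty_subset s)).sub (hw' n)
    rw [← gradient_sub (hψ n).differentiable (hw' n).differentiable]
    exact hC _ hsub.contDiff_one hsub.hasCompactSupport
  have hψu : Tendsto (fun n => eLpNorm (ψ n - u) (ENNReal.ofReal (critExp N))) atTop (𝓝 0) := by
    refine tendsto_eLpNorm_sub_of_tendsto_eLpNorm_sub
      (fun n => (hψ n).continuous.aestronglyMeasurable)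
      (fun n => (hw' n).continuous.aestronglyMeasurable) huLp.1 (one_le_ofReal_critExp N)
      (tendsto_of_tendsto_of_tendsto_of_le_of_le tendsto_const_nhds ?_ (fun _ => zero_le)
        hsobolev) hwu
    simpa only [mul_zero] using ENNReal.Tendsto.const_mul hgrad (.inr (ENNReal.coe_ne_top (r := C)))
  have hψG : Tendsto (fun n => eLpNorm (gradient (ψ n) - G) 2) atTop (𝓝 0) :=
    tendsto_eLpNorm_sub_of_tendsto_eLpNorm_sub
      (fun n => (continuous_gradient (hψ n).contDiff_one).aestronglyMeasurable)
      (fun n => (continuous_gradient (hw' n).contDiff_one).aestronglyMeasurable) hG.1 one_le_two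
      hgrad hwG
  obtain ⟨ns, hns, hlim⟩ := (tendstoInMeasure_of_tendsto_eLpNorm (ofReal_critExp_ne_zero N)
    (fun n => (hψ n).continuous.aestronglyMeasurable) huLp.1 hψu).exists_seq_tendsto_ae
  exact ⟨fun n => ψ (ns n), fun n => hψ (ns n), hlim, hψG.comp hns.tendsto_atTop⟩

lemma exists_eLpNorm_critExp_le_of_hasD12Grad (N : ℕ) [Fact (3 ≤ N)] :
    ∃ C : NNReal, ∀ (u : RN N → ℝ) (G : RN N → RN N), HasD12Grad u G →
      eLpNorm u (ENNReal.ofReal (critExp N)) ≤ C * eLpNorm G 2 := by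
  obtain ⟨C, hC⟩ := exists_eLpNorm_critExp_le N
  refine ⟨C, fun u G ⟨huLp, hG, w, hw, hwu, hwG⟩ => ?_⟩
  have hlim : Tendsto (fun n => eLpNorm (w n - u) (ENNReal.ofReal (critExp N)) +
      C * (eLpNorm (gradient (w n) - G) 2 + eLpNorm G 2)) atTop (𝓝 (C * eLpNorm G 2)) := by
    simpa only [zero_add] using
      hwu.add (ENNReal.Tendsto.const_mul (hwG.add_const _) (.inr (ENNReal.coe_ne_top (r := C))))
  refine ge_of_tendsto' hlim fun n => ?_
  have hw1 : ContDiff ℝ 1 (w n) := (hw n).1.of_le (by simp)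
  have hu_le := eLpNorm_sub_le_add huLp.1 hw1.continuous.aestronglyMeasurable
    (aestronglyMeasurable_zero (μ := volume)) (one_le_ofReal_critExp N)
  have hgrad_le := eLpNorm_sub_le_add (continuous_gradient hw1).aestronglyMeasurable hG.1
    (aestronglyMeasurable_zero (μ := volume)) one_le_two
  rw [sub_zero, sub_zero] at hu_le hgrad_le
  rw [eLpNorm_sub_comm] at hu_le
  exact hu_le.trans (add_le_add_right ((hC (w n) hw1 (hw n).2).trans (by gcongr)) _)

lemma HasD12Grad.ae_eq_zero (hu : HasD12Grad u G) (hG : ∫ x, ‖G x‖ ^ 2 = 0) :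
    u =ᵐ[volume] 0 := by
  obtain ⟨C, hC⟩ := exists_eLpNorm_critExp_le_of_hasD12Grad N
  have hle := hC u G hu
  rw [eLpNorm_two_eq_sqrt hu.2.1, hG, Real.sqrt_zero, ENNReal.ofReal_zero, mul_zero] at hle
  exact (eLpNorm_eq_zero_iff hu.1.1 (ofReal_critExp_ne_zero N)).1 (nonpos_iff_eq_zero.1 hle)

end Density

section Regularization

variable {ε t : ℝ}

/-- A smooth positive function on the line that equals `t + ε` for `t ≥ 0` and `ε` for
`t ≤ -ε / 2`. Its inverse replaces `1 / (t + ε)` in test functions, where `t` is the value of an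
approximation of a positive function and may be negative. -/
noncomputable def smoothShift (ε t : ℝ) : ℝ :=
  ε + t * Real.smoothTransition (1 + 2 * t / ε)

lemma contDiff_smoothShift (ε : ℝ) : ContDiff ℝ ∞ (smoothShift ε) :=
  contDiff_const.add (contDiff_id.mul (Real.smoothTransition.contDiff.comp
    (contDiff_const.add ((contDiff_const.mul contDiff_id).div_const ε))))

lemma smoothShift_of_nonneg (hε : 0 ≤ ε) (ht : 0 ≤ t) : smoothShift ε t = t + ε := by
  have harg : 1 ≤ 1 + 2 * t / ε := le_add_of_nonneg_right (by positivity)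
  rw [smoothShift, Real.smoothTransition.one_of_one_le harg]
  ring

lemma smoothShift_of_le (hε : 0 < ε) (ht : t ≤ -(ε / 2)) : smoothShift ε t = ε := by
  have harg : 2 * t / ε ≤ -1 := by
    rw [div_le_iff₀ hε]
    linarith
  rw [smoothShift, Real.smoothTransition.zero_of_nonpos (by linarith), mul_zero, add_zero]

lemma half_le_smoothShift (hε : 0 < ε) (t : ℝ) : ε / 2 ≤ smoothShift ε t := by
  rcases le_total t (-(ε / 2)) with hneg | hgt
  · rw [smoothShift_of_le hε hneg]
    linarith
  · have h0 := Real.smoothTransition.nonneg (1 + 2 * t / ε)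
    have h1 := Real.smoothTransition.le_one (1 + 2 * t / ε)
    rw [smoothShift]
    nlinarith

lemma contDiff_inv_smoothShift (hε : 0 < ε) : ContDiff ℝ ∞ fun t => (smoothShift ε t)⁻¹ :=
  (contDiff_smoothShift ε).inv fun t => by linarith [half_le_smoothShift hε t]

lemma abs_inv_smoothShift_le (hε : 0 < ε) (t : ℝ) : |(smoothShift ε t)⁻¹| ≤ 2 / ε := by
  have hlow := half_le_smoothShift hε t
  rw [abs_of_nonneg (inv_nonneg.2 (by linarith)), ← inv_div]
  exact inv_anti₀ (by positivity) hlow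

lemma deriv_inv_smoothShift_of_pos (hε : 0 < ε) (ht : 0 < t) :
    deriv (fun s => (smoothShift ε s)⁻¹) t = -((t + ε)⁻¹ ^ 2) := by
  have heq : (fun s => (smoothShift ε s)⁻¹) =ᶠ[𝓝 t] fun s => (s + ε)⁻¹ := by
    filter_upwards [Ioi_mem_nhds ht] with s hs
    rw [smoothShift_of_nonneg hε.le (le_of_lt hs)]
  have hderiv : HasDerivAt (fun s : ℝ => (s + ε)⁻¹) (-1 / (t + ε) ^ 2) t :=
    ((hasDerivAt_id t).add_const ε).inv (by simp only [id_eq]; linarith)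
  rw [heq.deriv_eq, hderiv.deriv, inv_pow, neg_div, one_div]

lemma exists_abs_deriv_inv_smoothShift_le (hε : 0 < ε) :
    ∃ C, ∀ t, |deriv (fun s => (smoothShift ε s)⁻¹) t| ≤ C := by
  obtain ⟨M, hM⟩ := (isCompact_Icc (a := -(ε / 2)) (b := 0)).exists_bound_of_continuousOn
    ((contDiff_inv_smoothShift hε).continuous_deriv (by simp)).continuousOn
  refine ⟨max M (ε⁻¹ ^ 2), fun t => ?_⟩
  rcases lt_or_ge t (-(ε / 2)) with hneg | hge
  · have heq : (fun s => (smoothShift ε s)⁻¹) =ᶠ[𝓝 t] fun _ => ε⁻¹ := by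
      filter_upwards [Iio_mem_nhds hneg] with s hs
      rw [smoothShift_of_le hε (le_of_lt hs)]
    rw [heq.deriv_eq, deriv_const, abs_zero]
    exact le_max_of_le_right (sq_nonneg _)
  · rcases lt_or_ge 0 t with hpos | hle
    · rw [deriv_inv_smoothShift_of_pos hε hpos, abs_neg, abs_of_nonneg (sq_nonneg _)]
      refine le_max_of_le_right ?_
      gcongr
      linarith
    · exact le_max_of_le_left (hM t ⟨hge, hle⟩)

end Regularization

section LocallyIntegrable

variable {E F : Type*} [NormedAddCommGroup E] [MeasurableSpace E] [NormedAddCommGroup F]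
  {μ : Measure E}

lemma locallyIntegrable_norm_rpow [IsLocallyFiniteMeasure μ] {f : E → F} {p q : ℝ} (hq : 0 < q)
    (hqp : q ≤ p) (hf : MemLp f (ENNReal.ofReal p) μ) :
    LocallyIntegrable (fun x => ‖f x‖ ^ q) μ := by
  have hq0 : ENNReal.ofReal q ≠ 0 := (ENNReal.ofReal_pos.2 hq).ne'
  have hmem := hf.norm_rpow_div (ENNReal.ofReal q)
  rw [ENNReal.toReal_ofReal hq.le] at hmem
  refine hmem.locallyIntegrable ?_
  rw [ENNReal.le_div_iff_mul_le (Or.inl hq0) (Or.inl ENNReal.ofReal_ne_top), one_mul]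
  exact ENNReal.ofReal_le_ofReal hqp

lemma IsTestFunction.integrable_mul_mul [NormedSpace ℝ E] [OpensMeasurableSpace E]
    {s : Set E} {φ V u : E → ℝ} (hφ : IsTestFunction s φ) (hs : IsClosed s)
    (hV : ContinuousOn V sᶜ) (hu : LocallyIntegrable u μ) :
    Integrable (fun x => V x * u x * φ x) μ := by
  have hVφ := hφ.continuous_mul hs hV hφ.continuous (subset_tsupport φ)
  refine (hu.integrable_smul_left_of_hasCompactSupport hVφ
    hφ.hasCompactSupport.mul_left).congr (.of_forall fun x => ?_)
  simp only [smul_eq_mul]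
  ring

lemma IsTestFunction.integrable_mul_of_locallyIntegrable [NormedSpace ℝ E]
    [OpensMeasurableSpace E] {s : Set E} {φ u : E → ℝ} (hφ : IsTestFunction s φ)
    (hu : LocallyIntegrable u μ) : Integrable (fun x => u x * φ x) μ := by
  simpa only [smul_eq_mul, mul_comm] using
    hu.integrable_smul_left_of_hasCompactSupport hφ.continuous hφ.hasCompactSupport

end LocallyIntegrable

section PositiveSupersolution

variable {N : ℕ} {s : Set (RN N)} {u v f φ : RN N → ℝ} {G : RN N → RN N}

lemma rpow_critExp_sub_one {t : ℝ} (ht : 0 < t) :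
    t ^ (critExp N - 1) = t ^ (critExp N - 2) * t := by
  rw [← Real.rpow_add_one ht.ne']
  ring_nf

/-- The equation `-div G = f` on the complement of `s`, in the sense of distributions. -/
def HasWeakNegDiv (s : Set (RN N)) (G : RN N → RN N) (f : RN N → ℝ) : Prop :=
  ∀ φ, IsTestFunction s φ → ∫ x, ⟪G x, gradient φ x⟫ = ∫ x, f x * φ x

lemma gradient_comp_mul_sq {E : Type*} [NormedAddCommGroup E] [InnerProductSpace ℝ E]
    [CompleteSpace E] {q : ℝ → ℝ} {w φ : E → ℝ} {x : E} (hq : DifferentiableAt ℝ q (w x))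
    (hw : DifferentiableAt ℝ w x) (hφ : DifferentiableAt ℝ φ x) :
    gradient (fun y => q (w y) * φ y ^ 2) x =
      (φ x ^ 2 * deriv q (w x)) • gradient w x + (2 * φ x * q (w x)) • gradient φ x := by
  rw [gradient_mul (f := fun y => q (w y)) (g := fun y => φ y ^ 2) (hq.comp x hw) (hφ.pow 2),
    gradient_scomp hq hw,
    gradient_scomp (F := fun t => t ^ 2) (differentiableAt_pow 2) hφ, deriv_pow_field]
  module

lemma HasWeakNegDiv.integral_eq_of_isTestFunction (hGf : HasWeakNegDiv s G f) (hG : MemLp G 2)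
    {q : ℝ → ℝ} (hq : ContDiff ℝ ∞ q) {w : RN N → ℝ} (hw : IsTestFunction ∅ w)
    (hφ : IsTestFunction s φ) :
    (∫ x, ⟪(φ x ^ 2 * deriv q (w x)) • G x, gradient w x⟫) +
        (∫ x, ⟪(2 * φ x * q (w x)) • G x, gradient φ x⟫) =
      ∫ x, f x * φ x ^ 2 * q (w x) := by
  have hqw : ContDiff ℝ ∞ fun x => q (w x) := hq.comp hw.contDiff
  have hq'w : Continuous fun x => deriv q (w x) :=
    (hq.continuous_deriv (by simp)).comp hw.continuous
  have hint {c : RN N → ℝ} (hc : Continuous c) {ψ : RN N → ℝ} {t : Set (RN N)}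
      (hψ : IsTestFunction t ψ) : Integrable fun x => ⟪c x • G x, gradient ψ x⟫ := by
    have hmem : MemLp (fun x => c x • gradient ψ x) 2 :=
      (hc.smul (continuous_gradient hψ.contDiff_one)).memLp_of_hasCompactSupport
        (hψ.hasCompactSupport.mono' (support_gradient_subset ψ)).smul_left
    simpa only [real_inner_smul_left, real_inner_smul_right] using
      integrable_inner_of_memLp_two hG hmem
  have hint_grad := hint (c := fun x => φ x ^ 2 * deriv q (w x)) ((hφ.continuous.pow 2).mul hq'w) hw
  have hint_cross := hint (c := fun x => 2 * φ x * q (w x))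
    ((hφ.continuous.const_mul 2).mul hqw.continuous) hφ
  rw [← integral_add hint_grad hint_cross]
  have hweak := hGf _ (hφ.sq.mul_left hqw)
  convert hweak using 2 <;> ext x
  · rw [gradient_comp_mul_sq (hq.differentiable (by simp) _) (hw.differentiable x)
      (hφ.differentiable x), inner_add_right, real_inner_smul_left, real_inner_smul_left,
      real_inner_smul_right, real_inner_smul_right]
  · ring

lemma HasWeakNegDiv.integral_eq_comp_mul_sq [Fact (3 ≤ N)] (hGf : HasWeakNegDiv s G f)
    (hv : HasD12Grad v G) {q : ℝ → ℝ} {C C' : ℝ} (hq : ContDiff ℝ ∞ q) (hqC : ∀ t, |q t| ≤ C)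
    (hqC' : ∀ t, |deriv q t| ≤ C') (hφ : IsTestFunction s φ)
    (hfφ : Integrable fun x => f x * φ x ^ 2) :
    (∫ x, ⟪(φ x ^ 2 * deriv q (v x)) • G x, G x⟫) +
        (∫ x, ⟪(2 * φ x * q (v x)) • G x, gradient φ x⟫) =
      ∫ x, f x * φ x ^ 2 * q (v x) := by
  obtain ⟨w, hw, hwv, hwG⟩ := hv.exists_seq_isTestFunction Set.finite_empty
  have hwm (n) : AEStronglyMeasurable (w n) := (hw n).continuous.aestronglyMeasurable
  have hgφ : MemLp (gradient φ) 2 := memLp_gradient hφ.contDiff_one hφ.hasCompactSupport 2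
  have hlim_grad := hφ.sq.tendsto_integral_inner_mul_comp_smul (hq.continuous_deriv (by simp))
    hqC' hwm hv.1.1 hwv hv.2.1
    (fun n => memLp_gradient (hw n).contDiff_one (hw n).hasCompactSupport 2) hv.2.1 hwG
  have hlim_cross := (hφ.mul_left (contDiff_const (c := 2))).tendsto_integral_inner_mul_comp_smul
    hq.continuous hqC hwm hv.1.1 hwv hv.2.1 (fun _ => hgφ) hgφ (by simp)
  have hlim_rhs := tendsto_integral_mul_of_bounded
    (fun n => hq.continuous.comp_aestronglyMeasurable (hwm n))
    (fun n => .of_forall fun x => hqC (w n x))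
    (by filter_upwards [hwv] with x hx using (hq.continuous.tendsto _).comp hx) hfφ
  exact tendsto_nhds_unique ((hlim_grad.add hlim_cross).congr fun n =>
    hGf.integral_eq_of_isTestFunction hv.2.1 hq (hw n) hφ) hlim_rhs

lemma two_mul_inner_sub_le {F : Type*} [NormedAddCommGroup F] [InnerProductSpace ℝ F]
    (c : ℝ) (g w : F) : -c ^ 2 * ‖g‖ ^ 2 + 2 * c * ⟪g, w⟫ ≤ ‖w‖ ^ 2 := by
  have hsq := sq_nonneg ‖w - c • g‖
  rw [norm_sub_sq_real, real_inner_smul_right, norm_smul, mul_pow, Real.norm_eq_abs, sq_abs,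
    real_inner_comm] at hsq
  linarith

lemma HasWeakNegDiv.integral_mul_sq_mul_inv_le [Fact (3 ≤ N)] (hGf : HasWeakNegDiv s G f)
    (hv : HasD12Grad v G) (hpos : ∀ᵐ x, 0 < v x) (hφ : IsTestFunction s φ)
    (hfφ : Integrable fun x => f x * φ x ^ 2) {ε : ℝ} (hε : 0 < ε) :
    ∫ x, f x * φ x ^ 2 * (v x + ε)⁻¹ ≤ ∫ x, ‖gradient φ x‖ ^ 2 := by
  obtain ⟨C', hC'⟩ := exists_abs_deriv_inv_smoothShift_le hε
  have htest := hGf.integral_eq_comp_mul_sq hv (contDiff_inv_smoothShift hε)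
    (abs_inv_smoothShift_le hε) hC' hφ hfφ
  have hgφ : MemLp (gradient φ) 2 := memLp_gradient hφ.contDiff_one hφ.hasCompactSupport 2
  have hint_grad := integrable_inner_of_memLp_two (hφ.sq.memLp_mul_comp_smul
    ((contDiff_inv_smoothShift hε).continuous_deriv (by simp)) hC' hv.1.1 hv.2.1) hv.2.1
  have hint_cross := integrable_inner_of_memLp_two
    ((hφ.mul_left (contDiff_const (c := 2))).memLp_mul_comp_smul
      (contDiff_inv_smoothShift hε).continuous (abs_inv_smoothShift_le hε) hv.1.1 hv.2.1) hgφ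
  calc ∫ x, f x * φ x ^ 2 * (v x + ε)⁻¹
      = ∫ x, f x * φ x ^ 2 * (smoothShift ε (v x))⁻¹ := integral_congr_ae <| by
        filter_upwards [hpos] with x hx
        rw [smoothShift_of_nonneg hε.le hx.le]
    _ ≤ ∫ x, ‖gradient φ x‖ ^ 2 := by
      rw [← htest, ← integral_add hint_grad hint_cross]
      refine integral_mono_ae (hint_grad.add hint_cross)
        (integrable_normSq_gradient hφ.contDiff_one hφ.hasCompactSupport) ?_
      filter_upwards [hpos] with x hx
      rw [deriv_inv_smoothShift_of_pos hε hx, smoothShift_of_nonneg hε.le hx.le,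
        real_inner_smul_left, real_inner_smul_left, real_inner_self_eq_norm_sq]
      refine le_of_eq_of_le ?_
        (two_mul_inner_sub_le (φ x * (v x + ε)⁻¹) (G x) (gradient φ x))
      ring

/-- The Allegretto–Piepenbrink argument: test the equation with `φ² / (v + ε)` and let `ε → 0`. -/
lemma HasWeakNegDiv.integral_mul_sq_le [Fact (3 ≤ N)] {W : RN N → ℝ}
    (hGW : HasWeakNegDiv s G fun x => W x * v x) (hv : HasD12Grad v G) (hpos : ∀ᵐ x, 0 < v x)
    (hφ : IsTestFunction s φ) (hWφ : Integrable fun x => W x * φ x ^ 2)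
    (hWvφ : Integrable fun x => W x * v x * φ x ^ 2) :
    ∫ x, W x * φ x ^ 2 ≤ ∫ x, ‖gradient φ x‖ ^ 2 := by
  have hεlim : Tendsto (fun n : ℕ => 1 / ((n : ℝ) + 1)) atTop (𝓝 0) :=
    tendsto_one_div_add_atTop_nhds_zero_nat
  have hlim : Tendsto (fun n : ℕ => ∫ x, W x * φ x ^ 2 * (v x * (v x + 1 / ((n : ℝ) + 1))⁻¹))
      atTop (𝓝 (∫ x, W x * φ x ^ 2 * 1)) := by
    refine tendsto_integral_mul_of_bounded (C := 1)
      (fun n => hv.1.1.mul (hv.1.1.aemeasurable.add_const _).inv.aestronglyMeasurable)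
      (fun n => ?_) ?_ hWφ
    · filter_upwards [hpos] with x hx
      rw [abs_of_nonneg (by positivity), ← div_eq_mul_inv, div_le_one (by positivity)]
      exact le_add_of_nonneg_right (by positivity)
    · filter_upwards [hpos] with x hx
      simpa only [add_zero, mul_inv_cancel₀ hx.ne'] using
        ((hεlim.const_add (v x)).inv₀ (by simpa using hx.ne')).const_mul (v x)
  simp only [mul_one] at hlim
  refine le_of_tendsto' hlim fun n => ?_
  have hn := hGW.integral_mul_sq_mul_inv_le hv hpos hφ hWvφ (ε := 1 / ((n : ℝ) + 1))
    (by positivity)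
  refine le_of_eq_of_le (integral_congr_ae (.of_forall fun x => ?_)) hn
  ring

end PositiveSupersolution

section Solution

variable {N k : ℕ} {h : Fin k → Sph N → ℝ} {a : Fin k → RN N}
  {u v φ : RN N → ℝ}

lemma integrable_rpow_mul {s : Set (RN N)} (hu : MemLp u (ENNReal.ofReal (critExp N)))
    (hpos : ∀ᵐ x, 0 < u x) (hφ : IsTestFunction s φ) {q : ℝ} (hq : 0 < q) (hqp : q ≤ critExp N) :
    Integrable fun x => u x ^ q * φ x := by
  refine (hφ.integrable_mul_of_locallyIntegrable
    (locallyIntegrable_norm_rpow hq hqp hu)).congr ?_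
  filter_upwards [hpos] with x hx
  rw [Real.norm_of_nonneg hx.le]

lemma sum_integral_polePotential_mul (hh : ∀ i, Continuous (h i)) (hu : LocallyIntegrable u)
    (hφ : IsTestFunction (Set.range a) φ) :
    ∑ i, ∫ x, polePotential (h i) (a i) x * u x * φ x =
      ∫ x, (∑ i, polePotential (h i) (a i) x) * u x * φ x := by
  have hint (i) : Integrable fun x => polePotential (h i) (a i) x * u x * φ x :=
    (hφ.mono (Set.singleton_subset_iff.2 ⟨i, rfl⟩)).integrable_mul_mul isClosed_singleton
      (continuousOn_polePotential (hh i) (a i)) hu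
  rw [← integral_finsetSum _ fun i _ => hint i]
  simp only [Finset.sum_mul]

lemma quadForm_eq_of_isTestFunction (hh : ∀ i, Continuous (h i))
    (hφ : IsTestFunction (Set.range a) φ) (G : RN N → RN N) :
    quadForm h a φ G =
      (∫ x, ‖G x‖ ^ 2) - ∫ x, (∑ i, polePotential (h i) (a i) x) * φ x ^ 2 := by
  have hsum := sum_integral_polePotential_mul hh (locallyIntegrable_const 1) hφ.sq
  simp only [mul_one] at hsum
  rw [quadForm, hsum]

variable [Fact (3 ≤ N)]

lemma IsPositiveD12Solution.exists_hasWeakNegDiv (hh : ∀ i, Continuous (h i))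
    (hv : IsPositiveD12Solution h a v) :
    ∃ G, HasD12Grad v G ∧ HasWeakNegDiv (Set.range a) G fun x =>
      (∑ i, polePotential (h i) (a i) x + v x ^ (critExp N - 2)) * v x := by
  obtain ⟨hpos, G, hvG, hweak⟩ := hv
  have hp := two_lt_critExp N
  refine ⟨G, hvG, fun φ hφ => ?_⟩
  have hloc : LocallyIntegrable v := hvG.1.locallyIntegrable (one_le_ofReal_critExp N)
  rw [eq_add_of_sub_eq (hweak φ hφ.contDiff hφ.hasCompactSupport hφ.disjoint),
    sum_integral_polePotential_mul hh hloc hφ, ← integral_add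
      (integrable_rpow_mul hvG.1 hpos hφ (by linarith) (by linarith))
      (hφ.integrable_mul_mul (Set.finite_range a).isClosed (continuousOn_sum_polePotential hh a)
        hloc)]
  refine integral_congr_ae ?_
  filter_upwards [hpos] with x hx
  rw [rpow_critExp_sub_one hx]
  ring

lemma IsPositiveD12Solution.integral_rpow_mul_sq_le_quadForm (hh : ∀ i, Continuous (h i))
    (hv : IsPositiveD12Solution h a v) (hφ : IsTestFunction (Set.range a) φ) :
    ∫ x, v x ^ (critExp N - 2) * φ x ^ 2 ≤ quadForm h a φ (gradient φ) := by
  obtain ⟨G, hvG, hGW⟩ := hv.exists_hasWeakNegDiv hh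
  have hp := two_lt_critExp N
  have hclosed : IsClosed (Set.range a) := (Set.finite_range a).isClosed
  have hV := continuousOn_sum_polePotential hh a
  have hVφ := hφ.integrable_mul_sq (μ := volume) hclosed hV
  have hvφ := integrable_rpow_mul hvG.1 hv.1 hφ.sq (q := critExp N - 2) (by linarith)
    (by linarith)
  have hVvφ := hφ.sq.integrable_mul_mul hclosed hV
    (hvG.1.locallyIntegrable (one_le_ofReal_critExp N))
  have hvvφ := integrable_rpow_mul hvG.1 hv.1 hφ.sq (q := critExp N - 1) (by linarith)
    (by linarith)
  have hle := hGW.integral_mul_sq_le hvG hv.1 hφ ?_ ?_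
  · simp only [add_mul] at hle
    rw [integral_add hVφ hvφ] at hle
    rw [quadForm_eq_of_isTestFunction hh hφ]
    linarith
  · exact (hVφ.add hvφ).congr (.of_forall fun x => (add_mul _ _ _).symm)
  · refine (hVvφ.add hvvφ).congr ?_
    filter_upwards [hv.1] with x hx
    rw [Pi.add_apply, rpow_critExp_sub_one hx]
    ring

lemma IsPositiveD12Solution.mul_setIntegral_sq_le_quadForm (hh : ∀ i, Continuous (h i))
    (hv : IsPositiveD12Solution h a v) {η : ℝ} (hη : 0 < η) {S : Set (RN N)}
    (hS : MeasurableSet S) (hSv : ∀ᵐ x, x ∈ S → η ≤ v x) (hφ : IsTestFunction (Set.range a) φ) :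
    η ^ (critExp N - 2) * (∫ x in S, φ x ^ 2) ≤ quadForm h a φ (gradient φ) := by
  refine le_trans ?_ (hv.integral_rpow_mul_sq_le_quadForm hh hφ)
  obtain ⟨G, hvG, -⟩ := hv.2
  have hp := two_lt_critExp N
  rw [← integral_indicator_one_mul _ hS, ← integral_const_mul]
  refine integral_mono_ae ((integrable_indicator_one_mul hφ.integrable_sq hS).const_mul _)
    (integrable_rpow_mul hvG.1 hv.1 hφ.sq (by linarith) (by linarith)) ?_
  filter_upwards [hv.1, hSv] with x hx hxS
  by_cases hxs : x ∈ S
  · rw [Set.indicator_of_mem hxs, Pi.one_apply, one_mul]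
    exact mul_le_mul_of_nonneg_right (Real.rpow_le_rpow hη.le (hxS hxs) (by linarith))
      (sq_nonneg _)
  · rw [Set.indicator_of_notMem hxs, zero_mul, mul_zero]
    positivity

end Solution

section Coercivity

lemma setIntegral_le_setIntegral_add_sdiff {α : Type*} [MeasurableSpace α] {μ : Measure α}
    {f : α → ℝ} (hf : Integrable f μ) (hf0 : ∀ x, 0 ≤ f x) {S : Set α} (hS : MeasurableSet S)
    (K : Set α) : ∫ x in K, f x ∂μ ≤ (∫ x in S, f x ∂μ) + ∫ x in K \ S, f x ∂μ := by
  rw [← integral_inter_add_sdiff hS hf.integrableOn]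
  exact add_le_add_left (setIntegral_mono_set hf.integrableOn (.of_forall hf0)
    Set.inter_subset_right.eventuallyLE) _

lemma exists_measurableSet_forall_le_of_pos {α : Type*} [MeasurableSpace α] {μ : Measure α}
    {v : α → ℝ} (hv : AEMeasurable v μ) (hpos : ∀ᵐ x ∂μ, 0 < v x) {K : Set α}
    (hK : MeasurableSet K) (hKfin : μ K ≠ ⊤) {ε : ENNReal} (hε : 0 < ε) :
    ∃ (η : ℝ) (S : Set α), 0 < η ∧ MeasurableSet S ∧ (∀ᵐ x ∂μ, x ∈ S → η ≤ v x) ∧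
      μ (K \ S) < ε := by
  let v' := hv.mk v
  let S (n : ℕ) : Set α := {x | 1 / ((n : ℝ) + 1) ≤ v' x}
  have hS (n) : MeasurableSet (S n) := measurableSet_le measurable_const hv.measurable_mk
  have hanti : Antitone fun n => K \ S n := fun m n hmn =>
    Set.sdiff_subset_sdiff_right fun x (hx : _ ≤ v' x) =>
      (one_div_le_one_div_of_le (by positivity) (by gcongr)).trans hx
  have hnull : μ (⋂ n, K \ S n) = 0 := by
    rw [measure_eq_zero_iff_ae_notMem]
    filter_upwards [hpos, hv.ae_eq_mk] with x hx hxv hxS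
    obtain ⟨n, hn⟩ := exists_nat_one_div_lt (hx.trans_eq hxv)
    exact (Set.mem_iInter.1 hxS n).2 hn.le
  have hlim : Tendsto (fun n => μ (K \ S n)) atTop (𝓝 0) := by
    rw [← hnull]
    exact tendsto_measure_iInter_atTop (fun n => (hK.diff (hS n)).nullMeasurableSet) hanti
      ⟨0, ((measure_mono Set.sdiff_subset).trans_lt hKfin.lt_top).ne⟩
  obtain ⟨n, hn⟩ := (hlim.eventually_lt_const hε).exists
  refine ⟨1 / ((n : ℝ) + 1), S n, by positivity, hS n, ?_, hn⟩
  filter_upwards [hv.ae_eq_mk] with x hx hxS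
  rwa [hx]

variable {N k : ℕ} [Fact (3 ≤ N)] {h : Fin k → Sph N → ℝ} {a : Fin k → RN N}

lemma IsPositiveD12Solution.exists_coercive {v : RN N → ℝ} (hv : IsPositiveD12Solution h a v)
    (hh : ∀ i, Continuous (h i)) (ha : Function.Injective a)
    (hμ : ∀ i, sphereFirstEigenvalue (h i) > -((((N : ℝ) - 2) / 2) ^ 2))
    (hμsum : sphereFirstEigenvalue (fun θ => ∑ i, h i θ) > -((((N : ℝ) - 2) / 2) ^ 2)) :
    ∃ c : ℝ, 0 < c ∧ ∀ φ, IsTestFunction (Set.range a) φ →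
      c * (∫ x, ‖gradient φ x‖ ^ 2) ≤ quadForm h a φ (gradient φ) := by
  obtain ⟨δ, C₀, R, hδ, hloc⟩ := exists_localized_form_bound hh ha hμ hμsum
  set C := |C₀| + 1
  have hC : 0 < C := by positivity
  have hC₀C : C₀ ≤ C := (le_abs_self C₀).trans (le_add_of_nonneg_right zero_le_one)
  obtain ⟨t, ht, hsmall⟩ := exists_setIntegral_sq_le_of_measure_le N
    (show 0 < δ / (2 * C) by positivity)
  have hvm : AEMeasurable v := hv.2.choose_spec.1.1.1.aemeasurable
  set K : Set (RN N) := closedBall 0 R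
  have hK : MeasurableSet K := measurableSet_closedBall
  obtain ⟨η, S, hη, hS, hSv, hKS⟩ := exists_measurableSet_forall_le_of_pos hvm hv.1 hK
    measure_closedBall_lt_top.ne (ENNReal.ofReal_pos.2 ht)
  set b := η ^ (critExp N - 2)
  have hb : 0 < b := Real.rpow_pos_of_pos hη _
  refine ⟨(δ / 2) / (1 + C / b), by positivity, fun φ hφ => ?_⟩
  set D := ∫ x, ‖gradient φ x‖ ^ 2
  set Q := quadForm h a φ (gradient φ)
  have hQform : Q = D - ∫ x, (∑ i, polePotential (h i) (a i) x) * φ x ^ 2 :=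
    quadForm_eq_of_isTestFunction hh hφ _
  have hsplit : ∫ x in K, φ x ^ 2 ≤ (∫ x in S, φ x ^ 2) + ∫ x in K \ S, φ x ^ 2 :=
    setIntegral_le_setIntegral_add_sdiff hφ.integrable_sq (fun x => sq_nonneg _) hS K
  have hlarge : ∫ x in S, φ x ^ 2 ≤ Q / b := by
    rw [le_div_iff₀' hb]
    exact hv.mul_setIntegral_sq_le_quadForm hh hη hS hSv hφ
  have hrest := hsmall (K \ S) hKS.le φ hφ.contDiff_one hφ.hasCompactSupport
  have : 0 ≤ ∫ x in K, φ x ^ 2 := integral_nonneg fun x => sq_nonneg _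
  have hδD : δ * D ≤ Q + C * (Q / b + δ / (2 * C) * D) :=
    calc δ * D ≤ Q + C₀ * ∫ x in K, φ x ^ 2 := by linarith [hloc φ hφ]
      _ ≤ Q + C * ∫ x in K, φ x ^ 2 := by gcongr
      _ ≤ Q + C * (Q / b + δ / (2 * C) * D) := by gcongr; linarith
  have hcancel : C * (Q / b + δ / (2 * C) * D) = C / b * Q + δ / 2 * D := by field_simp
  rw [div_mul_eq_mul_div, div_le_iff₀ (by positivity)]
  linarith

end Coercivity

section HardyLimit

variable {N : ℕ} {a : RN N}

lemma hardy_inequality {φ : RN N → ℝ} (hφ : IsTestFunction {a} φ) :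
    (((N : ℝ) - 2) / 2) ^ 2 * ∫ x, (‖x - a‖ ^ 2)⁻¹ * φ x ^ 2 ≤ ∫ x, ‖gradient φ x‖ ^ 2 := by
  have htranslate : IsTestFunction {0} (fun x => φ (x + a)) :=
    (hφ.comp_add_right a).mono (by simp)
  have hradial_le : ∫ x, (‖x‖ ^ 2)⁻¹ * ⟪gradient (fun y => φ (y + a)) x, x⟫ ^ 2 ≤
      ∫ x, ‖gradient (fun y => φ (y + a)) x‖ ^ 2 := by
    refine integral_mono htranslate.integrable_inv_normSq_mul_inner_sq
      (integrable_normSq_gradient htranslate.contDiff_one htranslate.hasCompactSupport) fun x => ?_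
    refine inv_mul_le_of_le_mul₀ (by positivity) (by positivity) ?_
    rw [← mul_pow, mul_comm ‖x‖]
    exact sq_le_sq' (neg_le_of_abs_le (abs_real_inner_le_norm _ x)) (real_inner_le_norm _ x)
  have hradial := (hardy_radial htranslate).trans hradial_le
  simp only [gradient_comp_add_right] at hradial
  rw [← integral_add_right_eq_self (fun x => (‖x - a‖ ^ 2)⁻¹ * φ x ^ 2) a,
    ← integral_add_right_eq_self (fun x => ‖gradient φ x‖ ^ 2) a]
  simpa only [add_sub_cancel_right] using hradial

lemma exists_eLpNorm_mul_le_of_abs_le_inv_norm [hN : Fact (3 ≤ N)] {W : RN N → ℝ} {M : ℝ}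
    (hW : ContinuousOn W {a}ᶜ) (hWM : ∀ x, |W x| ≤ M * ‖x - a‖⁻¹) :
    ∃ C : NNReal, ∀ φ, IsTestFunction {a} φ →
      eLpNorm (fun x => W x * φ x) 2 ≤ C * eLpNorm (gradient φ) 2 := by
  have h3 : (3 : ℝ) ≤ N := by exact_mod_cast hN.out
  set c : ℝ := ((N : ℝ) - 2) / 2 with hc
  have hc0 : 0 < c := by linarith
  refine ⟨(|M| / c).toNNReal, fun φ hφ => ?_⟩
  have hWφ := hφ.memLp_mul (μ := volume) isClosed_singleton hW 2
  have hle : ∫ x, ‖W x * φ x‖ ^ 2 ≤ (|M| / c) ^ 2 * ∫ x, ‖gradient φ x‖ ^ 2 := calc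
    ∫ x, ‖W x * φ x‖ ^ 2 ≤ ∫ x, M ^ 2 * ((‖x - a‖ ^ 2)⁻¹ * φ x ^ 2) := by
      refine integral_mono ((memLp_two_iff_integrable_sq_norm hWφ.1).1 hWφ)
        ((hφ.integrable_mul_sq isClosed_singleton
          (continuousOn_inv_normSq_sub a)).const_mul _) fun x => ?_
      have hsq := pow_le_pow_left₀ (abs_nonneg _) (hWM x) 2
      rw [sq_abs, mul_pow, inv_pow] at hsq
      simp only [Real.norm_eq_abs, sq_abs, mul_pow]
      rw [← mul_assoc]
      gcongr
    _ ≤ (|M| / c) ^ 2 * ∫ x, ‖gradient φ x‖ ^ 2 := by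
      rw [integral_const_mul, div_pow, sq_abs, div_mul_eq_mul_div, mul_div_assoc]
      gcongr
      rw [le_div_iff₀' (by positivity)]
      exact hardy_inequality hφ
  rw [eLpNorm_two_eq_sqrt hWφ, eLpNorm_two_eq_sqrt (memLp_gradient hφ.contDiff_one
    hφ.hasCompactSupport 2), ← ENNReal.ofReal_coe_nnreal, Real.coe_toNNReal _ (by positivity),
    ← ENNReal.ofReal_mul (by positivity)]
  gcongr
  rw [← Real.sqrt_sq (by positivity : 0 ≤ |M| / c), ← Real.sqrt_mul (sq_nonneg _)]
  exact Real.sqrt_le_sqrt hle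

lemma tendsto_eLpNorm_sub_of_tendsto_ae {α β F F' : Type*} [MeasurableSpace α] {μ : Measure α}
    [MeasurableSpace β] {ν : Measure β} [NormedAddCommGroup F] [NormedAddCommGroup F']
    {p q : ENNReal} {C : NNReal} {f : ℕ → α → F} {f₀ : α → F} {g : ℕ → β → F'} {g₀ : β → F'}
    (hf : ∀ n, AEStronglyMeasurable (f n) μ) (hg : ∀ n, AEStronglyMeasurable (g n) ν)
    (hg₀ : AEStronglyMeasurable g₀ ν) (hq : 1 ≤ q)
    (hfg : ∀ m n, eLpNorm (f m - f n) p μ ≤ C * eLpNorm (g m - g n) q ν)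
    (hlim : ∀ᵐ x ∂μ, Tendsto (fun n => f n x) atTop (𝓝 (f₀ x)))
    (hgl : Tendsto (fun n => eLpNorm (g n - g₀) q ν) atTop (𝓝 0)) :
    Tendsto (fun n => eLpNorm (f n - f₀) p μ) atTop (𝓝 0) := by
  have hfatou (n) : eLpNorm (f n - f₀) p μ ≤ C * eLpNorm (g n - g₀) q ν := by
    have hbound : Tendsto (fun m => C * (eLpNorm (g n - g₀) q ν + eLpNorm (g m - g₀) q ν)) atTop
        (𝓝 (C * eLpNorm (g n - g₀) q ν)) := by
      simpa only [add_zero] using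
        ENNReal.Tendsto.const_mul (hgl.const_add _) (.inr (ENNReal.coe_ne_top (r := C)))
    refine (Lp.eLpNorm_lim_le_liminf_eLpNorm (f := fun m => f n - f m)
      (fun m => (hf n).sub (hf m)) _ ?_).trans
      ((liminf_le_liminf (.of_forall fun m => (hfg n m).trans ?_)).trans_eq hbound.liminf_eq)
    · filter_upwards [hlim] with x hx using hx.const_sub _
    · gcongr
      rw [eLpNorm_sub_comm (g m)]
      exact eLpNorm_sub_le_add (hg n) hg₀ (hg m) hq
  refine tendsto_of_tendsto_of_tendsto_of_le_of_le tendsto_const_nhds ?_ (fun _ => zero_le) hfatou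
  simpa only [mul_zero] using ENNReal.Tendsto.const_mul hgl (.inr (ENNReal.coe_ne_top (r := C)))

lemma memLp_of_tendsto_eLpNorm_sub {α F : Type*} [MeasurableSpace α] {μ : Measure α}
    [NormedAddCommGroup F] {p : ENNReal} {f : ℕ → α → F} {f₀ : α → F} (hf : ∀ n, MemLp (f n) p μ)
    (hf₀ : AEStronglyMeasurable f₀ μ)
    (hlim : Tendsto (fun n => eLpNorm (f n - f₀) p μ) atTop (𝓝 0)) : MemLp f₀ p μ := by
  obtain ⟨n, hn⟩ := (hlim.eventually_lt_const ENNReal.zero_lt_top).exists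
  simpa only [sub_sub_cancel] using (hf n).sub ⟨(hf n).1.sub hf₀, hn⟩

variable [Fact (3 ≤ N)] {ψ : ℕ → RN N → ℝ} {u : RN N → ℝ} {G : RN N → RN N}

lemma tendsto_eLpNorm_mul_of_abs_le_inv_norm {W : RN N → ℝ} {M : ℝ} (hW : ContinuousOn W {a}ᶜ)
    (hWM : ∀ x, |W x| ≤ M * ‖x - a‖⁻¹) (hψ : ∀ n, IsTestFunction {a} (ψ n))
    (hG : AEStronglyMeasurable G) (hψu : ∀ᵐ x, Tendsto (fun n => ψ n x) atTop (𝓝 (u x)))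
    (hψG : Tendsto (fun n => eLpNorm (gradient (ψ n) - G) 2) atTop (𝓝 0)) :
    MemLp (fun x => W x * u x) 2 ∧
      Tendsto (fun n => eLpNorm ((fun x => W x * ψ n x) - fun x => W x * u x) 2) atTop (𝓝 0) := by
  obtain ⟨C, hC⟩ := exists_eLpNorm_mul_le_of_abs_le_inv_norm hW hWM
  have hmem (n) : MemLp (fun x => W x * ψ n x) 2 := (hψ n).memLp_mul isClosed_singleton hW 2
  have hlim_ae : ∀ᵐ x, Tendsto (fun n => W x * ψ n x) atTop (𝓝 (W x * u x)) := by
    filter_upwards [hψu] with x hx using hx.const_mul _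
  have hlim : Tendsto (fun n => eLpNorm ((fun x => W x * ψ n x) - fun x => W x * u x) 2)
      atTop (𝓝 0) := by
    refine tendsto_eLpNorm_sub_of_tendsto_ae (C := C) (fun n => (hmem n).1)
      (fun n => (continuous_gradient (hψ n).contDiff_one).aestronglyMeasurable) hG one_le_two
      (fun m n => ?_) hlim_ae hψG
    rw [← gradient_sub (hψ m).differentiable (hψ n).differentiable]
    refine le_of_eq_of_le ?_ (hC _ ((hψ m).sub (hψ n)))
    congr 1
    ext x
    exact (mul_sub _ _ _).symm
  exact ⟨memLp_of_tendsto_eLpNorm_sub hmem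
    (aestronglyMeasurable_of_tendsto_ae atTop (fun n => (hmem n).1) hlim_ae) hlim, hlim⟩

lemma tendsto_integral_polePotential_mul_sq {h : Sph N → ℝ} (hh : Continuous h)
    (hψ : ∀ n, IsTestFunction {a} (ψ n)) (hG : AEStronglyMeasurable G)
    (hψu : ∀ᵐ x, Tendsto (fun n => ψ n x) atTop (𝓝 (u x)))
    (hψG : Tendsto (fun n => eLpNorm (gradient (ψ n) - G) 2) atTop (𝓝 0)) :
    Tendsto (fun n => ∫ x, polePotential h a x * ψ n x ^ 2) atTop
      (𝓝 (∫ x, polePotential h a x * u x ^ 2)) := by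
  obtain ⟨M, hM0, hM⟩ := exists_abs_le_of_continuous hh
  have hinv : ContinuousOn (fun x : RN N => ‖x - a‖⁻¹) {a}ᶜ :=
    ContinuousOn.inv₀ (by fun_prop) fun x hx => norm_ne_zero_iff.2 (sub_ne_zero.2 hx)
  have hang : ContinuousOn (fun x : RN N => angular h (x - a) * ‖x - a‖⁻¹) {a}ᶜ :=
    ((continuousOn_angular hh).comp (by fun_prop) fun x hx => sub_ne_zero.2 hx).mul hinv
  obtain ⟨hu_inv, hlim_inv⟩ := tendsto_eLpNorm_mul_of_abs_le_inv_norm (M := 1) hinv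
    (fun x => by rw [one_mul, abs_inv, abs_norm]) hψ hG hψu hψG
  obtain ⟨hu_ang, hlim_ang⟩ := tendsto_eLpNorm_mul_of_abs_le_inv_norm (M := M) hang (fun x => by
    rw [abs_mul, abs_inv, abs_norm]
    gcongr
    exact abs_angular_le hM hM0 _) hψ hG hψu hψG
  have hlim := tendsto_integral_inner_of_tendsto_eLpNorm
    (fun n => (hψ n).memLp_mul isClosed_singleton hang 2)
    (fun n => (hψ n).memLp_mul isClosed_singleton hinv 2) hu_ang hu_inv hlim_ang hlim_inv
  have hprod (f : RN N → ℝ) (x) : ⟪angular h (x - a) * ‖x - a‖⁻¹ * f x, ‖x - a‖⁻¹ * f x⟫ =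
      polePotential h a x * f x ^ 2 := by
    rw [polePotential, real_inner_eq_re_inner, RCLike.inner_apply, conj_trivial, RCLike.re_to_real,
      div_eq_mul_inv, ← inv_pow]
    ring
  simpa only [hprod] using hlim

lemma HasD12Grad.mul_integral_le_quadForm {k : ℕ} {h : Fin k → Sph N → ℝ}
    {a : Fin k → RN N} {c : ℝ} (hh : ∀ i, Continuous (h i))
    (hc : ∀ φ, IsTestFunction (Set.range a) φ →
      c * ∫ x, ‖gradient φ x‖ ^ 2 ≤ quadForm h a φ (gradient φ)) (hu : HasD12Grad u G) :
    c * ∫ x, ‖G x‖ ^ 2 ≤ quadForm h a u G := by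
  obtain ⟨ψ, hψ, hψu, hψG⟩ := hu.exists_seq_isTestFunction (Set.finite_range a)
  have hgrad (n) : MemLp (gradient (ψ n)) 2 :=
    memLp_gradient (hψ n).contDiff_one (hψ n).hasCompactSupport 2
  have hlim_grad : Tendsto (fun n => ∫ x, ‖gradient (ψ n) x‖ ^ 2) atTop (𝓝 (∫ x, ‖G x‖ ^ 2)) := by
    simpa only [real_inner_self_eq_norm_sq] using
      tendsto_integral_inner_of_tendsto_eLpNorm hgrad hgrad hu.2.1 hu.2.1 hψG hψG
  have hlim_pot (i) := tendsto_integral_polePotential_mul_sq (hh i) (a := a i)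
    (fun n => (hψ n).mono (Set.singleton_subset_iff.2 (Set.mem_range_self i))) hu.2.1.1 hψu hψG
  exact le_of_tendsto_of_tendsto' (hlim_grad.const_mul c)
    (hlim_grad.sub (tendsto_finsetSum _ fun i _ => hlim_pot i)) fun n => hc _ (hψ n)

end HardyLimit

lemma IsPositiveD12Solution.not_ae_eq_zero {N k : ℕ} [Fact (3 ≤ N)] {h : Fin k → Sph N → ℝ}
    {a : Fin k → RN N} {v : RN N → ℝ} (hv : IsPositiveD12Solution h a v) :
    ¬ v =ᵐ[volume] 0 := fun hv0 => by
  have := nontrivial_RN N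
  obtain ⟨x, hx0, hx⟩ := (hv0.and hv.1).exists
  exact hx.ne' hx0

theorem propositionp_general (N : ℕ) [Fact (3 ≤ N)] (k : ℕ)
    (h : Fin k → Sph N → ℝ) (hh : ∀ i, Continuous (h i))
    (a : Fin k → RN N) (ha : Function.Injective a)
    (hμ : ∀ i, sphereFirstEigenvalue (h i) > -((((N : ℝ) - 2) / 2) ^ 2))
    (hμsum : sphereFirstEigenvalue (fun θ => ∑ i, h i θ) > -((((N : ℝ) - 2) / 2) ^ 2))
    (hsol : ∃ u : RN N → ℝ, IsPositiveD12Solution h a u) :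
    formInf h a > 0 := by
  obtain ⟨v, hv⟩ := hsol
  obtain ⟨c, hc, hcoercive⟩ := hv.exists_coercive hh ha hμ hμsum
  obtain ⟨Gv, hGv, -⟩ := hv.2
  refine hc.trans_le (le_csInf ⟨_, v, Gv, hGv, hv.not_ae_eq_zero, rfl⟩ ?_)
  rintro _ ⟨u, G, hu, hu0, rfl⟩
  have hG : 0 < ∫ x, ‖G x‖ ^ 2 := (integral_nonneg fun _ => sq_nonneg _).lt_of_ne'
    fun hG0 => hu0 (hu.ae_eq_zero hG0)
  rw [le_div_iff₀ hG]
  exact hu.mul_integral_le_quadForm hh hcoercive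

theorem propositionp (N : ℕ) [Fact (3 ≤ N)] (k : ℕ)
    (h : Fin k → Sph N → ℝ) (hh : ∀ i, SphereContDiff 1 (h i))
    (a : Fin k → RN N) (ha : Function.Injective a)
    (hμ : ∀ i, sphereFirstEigenvalue (h i) > -((((N : ℝ) - 2) / 2) ^ 2))
    (hμsum : sphereFirstEigenvalue (fun θ => ∑ i, h i θ) > -((((N : ℝ) - 2) / 2) ^ 2))
    (hsol : ∃ u : RN N → ℝ, IsPositiveD12Solution h a u) :
    formInf h a > 0 :=
  propositionp_general N k h (fun i => (hh i).continuous) a ha hμ hμsum hsol
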